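/- **Conventions.** A symmetric multicategory $M$ (coloured operad) has objects, arrows $f:A_1,\dots,A_n\to A$ from finite families of objects to objects ($n\ge 0$), identities $\mathrm{id}_A:A\to A$, composites $f(g_1,\dots,g_n)$, and an action of bijections of the domain, $f\mapsto \sigma f$, such that composition is associative, unital and compatible with the action and the action is functorial. Functors preserve all this structure; $\cong$ denotes isomorphism of symmetric multicategories, that is, a functor with a strict two-sided inverse. * For a category $C$, $C_\blacktriangleright$ is the symmetric multicategory with the objects of $C$ and with $C_\blacktriangleright(X_1,\dots,X_n;X)=C(X_1,X)\times\cdots\times C(X_n,X)$, with the evident composition and symmetric structure. $M$ is *sequential* if $M\cong C_\blacktriangleright$ for some category $C$. Write $1_\blacktriangleright$ for $C_\blacktriangleright$ with $C=1$ the terminal category, and $\star$ for its only object; it has exactly one $n$-ary arrow $\star,\dots,\star\to\star$ for each $n$. * $M_-$ is the category of objects and unary arrows of $M$. * $[M,N]$ is the symmetric multicategory whose objects are the functors $M\to N$ and whose arrows $F_1,\dots,F_n\to F$ are the families of arrows $\alpha_A:F_1A,\dots,F_nA\to FA$ ($A\in M$) with $Ff(\alpha_{A_1},\dots,\alpha_{A_m})=\sigma\,\alpha_A(F_1f,\dots,F_nf)$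 for all $f:A_1,\dots,A_m\to A$ in $M$, where $\sigma$ is the permutation that transposes the $n\times m$ array of inputs; composition and symmetric structure are pointwise. * The *center* of $M$ is the full sub-multicategory of $[M,M]$ on the object $\mathrm{id}_M$. A *central monoid* in $M$ is a functor $1_\blacktriangleright\to[M,M]$ that sends $\star$ to $\mathrm{id}_M$. A *central unital magma* in $M$ is a unital magma in the center of $M$: a $0$-ary arrow $e:\ \to\mathrm{id}_M$ and a binary arrow $\mu:\mathrm{id}_M,\mathrm{id}_M\to\mathrm{id}_M$ of $[M,M]$ such that $\mu(e,\mathrm{id})=\mathrm{id}=\mu(\mathrm{id},e)$. * The Boardman–Vogt tensor product $M\otimes N$ is the symmetric multicategory with object set $\mathrm{obj}\,M\times\mathrm{obj}\,N$ generated by the arrows $f_X:\langle A_1,X\rangle,\dots,\langle A_n,X\rangle\to\langle A,X\rangle$ ($f:A_1,\dots,A_n\to A$ in $M$, $X\in N$) and $h_A:\langle A,X_1\rangle,\dots,\langle A,X_m\rangle\to\langle A,X\rangle$ ($h:X_1,\dots,X_m\to X$ in $N$, $A\in M$), subject to the relations that make each $(-)_X:M\to M\otimes N$ and each $(-)_A:N\to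 M\otimes N$ a functor of symmetric multicategories and to $f_X(h_{A_1},\dots,h_{A_n})=\sigma\,h_A(f_{X_1},\dots,f_{X_m})$ for all such $f$ and $h$, with $\sigma$ the transposing permutation. **Proposition.** Let $M$ be a symmetric multicategory. The following are equivalent: 1. $M$ is sequential, that is, $M\cong C_\blacktriangleright$ for some category $C$. 2. $M\cong(M_-)_\blacktriangleright$. 3. $M$ has a central monoid $1_\blacktriangleright\to[M,M]$. 4. $M$ has a central unital magma. 5. The forgetful functor $[1_\blacktriangleright,M]\to M$, $F\mapsto F\star$, $\alpha\mapsto\alpha_\star$, is an isomorphism. 6. The canonical functor $M\to 1_\blacktriangleright\otimes M$, $A\mapsto\langle\star,A\rangle$, $f\mapsto f_\star$, is an isomorphism. -/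

import Mathlib

open CategoryTheory

universe u v u₁ v₁ u₂ v₂ u₃ v₃ u₄ v₄

/-! ### Bijections between index sets -/

namespace IndexEquiv

/-- The bijection `{⋆} × I ≃ I`. -/
def unitSigma (ι : Type) : (Σ _ : Unit, ι) ≃ ι where
  toFun p := p.2
  invFun i := ⟨(), i⟩
  left_inv _ := rfl
  right_inv _ := rfl

/-- The bijection `I × {⋆} ≃ I`. -/
def sigmaUnit (ι : Type) : (Σ _ : ι, Unit) ≃ ι where
  toFun p := p.1
  invFun i := ⟨i, ()⟩
  left_inv _ := rfl
  right_inv _ := rfl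

/-- The transposition `I × J ≃ J × I` (the "obvious permutation" of the interchange law). -/
def swap (ι κ : Type) : (Σ _ : ι, κ) ≃ (Σ _ : κ, ι) where
  toFun p := ⟨p.2, p.1⟩
  invFun p := ⟨p.2, p.1⟩
  left_inv _ := rfl
  right_inv _ := rfl

/-- The bijection `⨿_i K (σ i) ≃ ⨿_j K j` (block permutation) induced by `σ : I ≃ J`. -/
def block {ι ι' : Type} (σ : ι ≃ ι') (κ : ι' → Type) : (Σ i, κ (σ i)) ≃ (Σ j, κ j) :=
  (Equiv.sigmaCongrLeft σ : (Σ i, κ (σ i)) ≃ (Σ j, κ j))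

end IndexEquiv

/-! ### Symmetric multicategories -/

set_option linter.checkUnivs false in
/-- A symmetric multicategory (coloured operad). The domain of an arrow is a finite family
`(A i)_{i ∈ I}` of objects; an `n`-ary arrow `A₁, …, Aₙ → B` is the case `I = Fin n`. As usual
in the coordinate-free presentation, `I` may be any finite set, and bijections `σ : I ≃ J`
act on arrows by `act σ : Hom (A ∘ σ) B → Hom A B`; in particular all permutations of
`{1, …, n}` act. Given `f : (A i)_{i ∈ I} → B` and `g i : (D i j)_{j ∈ K i} → A i`,
the composite `f (g i)_{i ∈ I}` has the family of all the `D i j`, indexed by the disjoint union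
of the sets `K i`, as its domain. -/
structure SymmMulticat where
  /-- objects -/
  Obj : Type u
  /-- arrows from a finite family of objects to an object -/
  Hom : ∀ {ι : Type} [Finite ι], (ι → Obj) → Obj → Type v
  /-- identities -/
  ident : ∀ A : Obj, Hom (fun _ : Unit => A) A
  /-- composition -/
  comp : ∀ {ι : Type} [Finite ι] {κ : ι → Type} [∀ i, Finite (κ i)] {A : ι → Obj} {B : Obj}
    {D : ∀ i, κ i → Obj}, Hom A B → (∀ i, Hom (D i) (A i)) →
      Hom (fun p : (Σ i, κ i) => D p.1 p.2) B
  /-- action of bijections -/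
  act : ∀ {ι κ : Type} [Finite ι] [Finite κ] (σ : ι ≃ κ) {A : κ → Obj} {B : Obj},
    Hom (fun i => A (σ i)) B → Hom A B
  act_refl : ∀ {ι : Type} [Finite ι] {A : ι → Obj} {B : Obj} (f : Hom A B),
    act (Equiv.refl ι) (A := A) f = f
  act_act : ∀ {ι κ μ : Type} [Finite ι] [Finite κ] [Finite μ] (σ : ι ≃ κ) (τ : κ ≃ μ)
    {A : μ → Obj} {B : Obj} (f : Hom (fun i => A (τ (σ i))) B),
    act τ (act σ (A := fun j => A (τ j)) f) = act (σ.trans τ) (A := A) f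
  ident_comp : ∀ {ι : Type} [Finite ι] {A : ι → Obj} {B : Obj} (f : Hom A B),
    act (IndexEquiv.unitSigma ι) (A := A) (comp (ident B) (fun _ : Unit => f)) = f
  comp_ident : ∀ {ι : Type} [Finite ι] {A : ι → Obj} {B : Obj} (f : Hom A B),
    act (IndexEquiv.sigmaUnit ι) (A := A) (comp f (fun i => ident (A i))) = f
  assoc : ∀ {ι : Type} [Finite ι] {κ : ι → Type} [∀ i, Finite (κ i)]
    {μ : ∀ i, κ i → Type} [∀ i j, Finite (μ i j)] {A : ι → Obj} {B : Obj}
    {D : ∀ i, κ i → Obj} {E : ∀ i j, μ i j → Obj}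
    (f : Hom A B) (g : ∀ i, Hom (D i) (A i)) (h : ∀ i j, Hom (E i j) (D i j)),
    act (Equiv.sigmaAssoc μ) (A := fun q => E q.1 q.2.1 q.2.2)
      (comp (comp f g) (fun p => h p.1 p.2)) = comp f (fun i => comp (g i) (h i))
  comp_act : ∀ {ι : Type} [Finite ι] {κ κ' : ι → Type} [∀ i, Finite (κ i)]
    [∀ i, Finite (κ' i)] (σ : ∀ i, κ i ≃ κ' i) {A : ι → Obj} {B : Obj} {D : ∀ i, κ' i → Obj}
    (f : Hom A B) (g : ∀ i, Hom (fun j => D i (σ i j)) (A i)),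
    comp f (fun i => act (σ i) (A := D i) (g i)) =
      act (Equiv.sigmaCongrRight σ) (A := fun p => D p.1 p.2) (comp f g)
  act_comp : ∀ {ι ι' : Type} [Finite ι] [Finite ι'] (σ : ι ≃ ι') {κ : ι' → Type}
    [∀ j, Finite (κ j)] {A : ι' → Obj} {B : Obj} {D : ∀ j, κ j → Obj}
    (f : Hom (fun i => A (σ i)) B) (g : ∀ j, Hom (D j) (A j)),
    comp (act σ (A := A) f) g =
      act (IndexEquiv.block σ κ) (A := fun p => D p.1 p.2) (comp f (fun i => g (σ i)))

namespace SymmMulticat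

/-- A (symmetric) functor between symmetric multicategories. -/
structure Functor (M : SymmMulticat.{u₁, v₁}) (N : SymmMulticat.{u₂, v₂}) where
  /-- action on objects -/
  obj : M.Obj → N.Obj
  /-- action on arrows -/
  map : ∀ {ι : Type} [Finite ι] {A : ι → M.Obj} {B : M.Obj},
    M.Hom A B → N.Hom (fun i => obj (A i)) (obj B)
  map_ident : ∀ A : M.Obj, map (M.ident A) = N.ident (obj A)
  map_comp : ∀ {ι : Type} [Finite ι] {κ : ι → Type} [∀ i, Finite (κ i)] {A : ι → M.Obj}
    {B : M.Obj} {D : ∀ i, κ i → M.Obj} (f : M.Hom A B) (g : ∀ i, M.Hom (D i) (A i)),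
    map (M.comp f g) = N.comp (map f) (fun i => map (g i))
  map_act : ∀ {ι κ : Type} [Finite ι] [Finite κ] (σ : ι ≃ κ) {A : κ → M.Obj} {B : M.Obj}
    (f : M.Hom (fun i => A (σ i)) B),
    map (M.act σ (A := A) f) = N.act σ (A := fun j => obj (A j)) (map f)

namespace Functor

/-- The identity functor. -/
def idFunctor (M : SymmMulticat.{u, v}) : Functor M M where
  obj A := A
  map f := f
  map_ident _ := rfl
  map_comp _ _ := rfl
  map_act _ _ _ _ := rfl

/-- Composition of functors (in diagrammatic order). -/
def trans {L : SymmMulticat.{u₁, v₁}} {M : SymmMulticat.{u₂, v₂}} {N : SymmMulticat.{u₃, v₃}}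
    (F : Functor L M) (G : Functor M N) : Functor L N where
  obj A := G.obj (F.obj A)
  map f := G.map (F.map f)
  map_ident A := by rw [F.map_ident, G.map_ident]
  map_comp f g := by rw [F.map_comp, G.map_comp]
  map_act σ A B f := by rw [F.map_act, G.map_act σ (A := fun j => F.obj (A j))]

/-- A functor is an isomorphism if it has a (strict) two-sided inverse. -/
def IsIso {M : SymmMulticat.{u₁, v₁}} {N : SymmMulticat.{u₂, v₂}} (F : Functor M N) : Prop :=
  ∃ G : Functor N M, F.trans G = idFunctor M ∧ G.trans F = idFunctor N

end Functor

/-- Two symmetric multicategories are isomorphic. -/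
def Isomorphic (M : SymmMulticat.{u₁, v₁}) (N : SymmMulticat.{u₂, v₂}) : Prop :=
  ∃ F : Functor M N, F.IsIso

/-! ### Sequential multicategories and the underlying category -/

/-- Reindexing of a concurrent family of arrows `⟨f_i⟩` along a bijection. -/
def seqAct {C : Type u} [Category.{v} C] {ι κ : Type} (σ : ι ≃ κ) {A : κ → C} {B : C}
    (f : ∀ i, A (σ i) ⟶ B) : ∀ j, A j ⟶ B :=
  fun j => eqToHom (congrArg A (σ.apply_symm_apply j).symm) ≫ f (σ.symm j)

theorem seqAct_apply {C : Type u} [Category.{v} C] {ι κ : Type} (σ : ι ≃ κ) {A : κ → C} {B : C}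
    (f : ∀ i, A (σ i) ⟶ B) (i : ι) : seqAct σ f (σ i) = f i := by
  have key : ∀ (i' : ι) (h : i' = i) (h' : A (σ i) = A (σ i')), eqToHom h' ≫ f i' = f i := by
    rintro i' rfl h'
    simp
  exact key _ (σ.symm_apply_apply i) _

theorem seqAct_eq {C : Type u} [Category.{v} C] {ι κ : Type} (σ : ι ≃ κ) {A : κ → C} {B : C}
    (f : ∀ i, A (σ i) ⟶ B) (g : ∀ j, A j ⟶ B) (h : ∀ i, f i = g (σ i)) : seqAct σ f = g := by
  funext j
  obtain ⟨i, rfl⟩ := σ.surjective j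
  rw [seqAct_apply, h]

/-- The multicategory `C▸` of discrete cocones in a category `C`: an arrow `A₁, …, Aₙ → B` is a
sequence `⟨f₁, …, fₙ⟩` of arrows `f_i : A_i ⟶ B` of `C`. -/
def sequential (C : Type u) [Category.{v} C] : SymmMulticat.{u, v} where
  Obj := C
  Hom A B := ∀ i, A i ⟶ B
  ident A := fun _ => 𝟙 A
  comp f g := fun p => g p.1 p.2 ≫ f p.1
  act σ _ _ f := seqAct σ f
  act_refl f := seqAct_eq _ _ _ (fun _ => rfl)
  act_act {_ _ _ _ _ _} σ τ {A} {_} f := by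
    refine (seqAct_eq _ _ _ fun i => ?_).symm
    exact ((seqAct_apply τ _ _).trans (seqAct_apply σ (A := fun j => A (τ j)) f i)).symm
  ident_comp f := seqAct_eq _ _ _ (fun p => Category.comp_id _)
  comp_ident f := seqAct_eq _ _ _ (fun p => Category.id_comp _)
  assoc f g h := seqAct_eq _ _ _ (fun p => (Category.assoc _ _ _).symm)
  comp_act {_} _ {_ _} _ _ σ {_ _ D} f g := by
    refine (seqAct_eq _ _ _ fun p => ?_).symm
    exact congrArg (· ≫ f p.1) (seqAct_apply (σ p.1) (A := D p.1) (g p.1) p.2).symm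
  act_comp {_ _ _ _} σ {_} _ {A} {_ _} f g := by
    refine (seqAct_eq _ _ _ fun p => ?_).symm
    exact congrArg (g (σ p.1) p.2 ≫ ·) (seqAct_apply σ (A := A) f p.1).symm

/-- `M` is sequential if it is isomorphic to `C▸` for some category `C`. -/
def IsSequential (M : SymmMulticat.{u, v}) : Prop :=
  ∃ (C : Type u) (_ : Category.{v} C), Isomorphic M (sequential C)

theorem act_heq (M : SymmMulticat.{u, v}) {ι κ : Type} [Finite ι] [Finite κ] {σ τ : ι ≃ κ}
    (h : σ = τ) {A : κ → M.Obj} {B : M.Obj} {f : M.Hom (fun i => A (σ i)) B}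
    {g : M.Hom (fun i => A (τ i)) B} (hfg : f ≍ g) :
    M.act σ (A := A) f = M.act τ (A := A) g := by
  subst h
  rw [eq_of_heq hfg]

/-- Composition `g ∘ f` of unary arrows. -/
def unaryComp (M : SymmMulticat.{u, v}) {X Y Z : M.Obj} (f : M.Hom (fun _ : Unit => X) Y)
    (g : M.Hom (fun _ : Unit => Y) Z) : M.Hom (fun _ : Unit => X) Z :=
  M.act (IndexEquiv.unitSigma Unit) (A := fun _ => X) (M.comp g (fun _ : Unit => f))

theorem unaryComp_assoc (M : SymmMulticat.{u, v}) {W X Y Z : M.Obj}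
    (f : M.Hom (fun _ : Unit => W) X) (g : M.Hom (fun _ : Unit => X) Y)
    (h : M.Hom (fun _ : Unit => Y) Z) :
    M.unaryComp (M.unaryComp f g) h = M.unaryComp f (M.unaryComp g h) := by
  let c := M.comp (M.comp h (fun _ : Unit => g)) (fun _ : Σ _ : Unit, Unit => f)
  let σ := IndexEquiv.unitSigma Unit
  have h1 := M.comp_act (fun _ : Unit => σ) (D := fun _ _ => W) h
    (fun _ => M.comp g (fun _ : Unit => f))
  have h2 := M.act_comp σ (A := fun _ => X) (D := fun _ (_ : Unit) => W)
    (M.comp h (fun _ : Unit => g)) (fun _ : Unit => f)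
  have h3 := M.assoc h (fun _ : Unit => g) (fun _ _ => f)
  calc
    _ = M.act σ (A := fun _ => W) (M.act (Equiv.sigmaCongrRight fun _ : Unit => σ)
          (A := fun _ => W) (M.act (Equiv.sigmaAssoc fun _ _ => Unit) (A := fun _ => W) c)) :=
        congrArg (M.act σ (A := fun _ => W)) (h1.trans
          (congrArg (M.act (Equiv.sigmaCongrRight fun _ : Unit => σ) (A := fun _ => W))
            h3.symm))
    _ = M.act σ (A := fun _ => W) (M.act (IndexEquiv.block σ fun _ => Unit)
          (A := fun _ => W) c) := by
        rw [M.act_act _ _ (A := fun _ => W), M.act_act _ _ (A := fun _ => W),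
          M.act_act _ _ (A := fun _ => W)]
        exact M.act_heq (Equiv.ext fun _ => rfl) HEq.rfl
    _ = _ := congrArg (M.act σ (A := fun _ => W)) h2.symm

/-- The objects of the underlying category `M₋` of a multicategory. -/
def Underlying (M : SymmMulticat.{u, v}) : Type u := M.Obj

/-- The underlying category `M₋`: its arrows are the unary arrows of `M`. -/
instance underlyingCategory (M : SymmMulticat.{u, v}) : Category.{v} (Underlying M) where
  Hom X Y := M.Hom (fun _ : Unit => X) Y
  id X := M.ident X
  comp f g := M.unaryComp f g
  id_comp f := M.comp_ident f
  comp_id f := M.ident_comp f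
  assoc f g h := M.unaryComp_assoc f g h

/-! ### The internal hom -/

/-- The arrows `F_1, …, F_n → G` of `[M, N]`: families of arrows
`α_A : F_1 A, …, F_n A → G A` such that `Gf(α_{A_1}, …, α_{A_m}) = σ α_A(F_1 f, …, F_n f)`
for every arrow `f : A_1, …, A_m → A` of `M`. -/
structure MultiNat {M : SymmMulticat.{u₁, v₁}} {N : SymmMulticat.{u₂, v₂}} {ι : Type} [Finite ι]
    (F : ι → Functor M N) (G : Functor M N) where
  /-- the components -/
  app : ∀ A : M.Obj, N.Hom (fun i => (F i).obj A) (G.obj A)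
  natural : ∀ {μ : Type} [Finite μ] {A : μ → M.Obj} {B : M.Obj} (f : M.Hom A B),
    N.comp (G.map f) (fun a => app (A a)) =
      N.act (IndexEquiv.swap ι μ) (A := fun p => (F p.2).obj (A p.1))
        (N.comp (app B) (fun i => (F i).map f))

theorem MultiNat.ext' {M : SymmMulticat.{u₁, v₁}} {N : SymmMulticat.{u₂, v₂}} {ι : Type}
    [Finite ι] {F : ι → Functor M N} {G : Functor M N} {α β : MultiNat F G}
    (h : ∀ A, α.app A = β.app A) : α = β := by
  cases α
  cases β
  congr
  exact funext h

/-- The identity of `F` in `[M, N]`. -/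
def MultiNat.ident {M : SymmMulticat.{u₁, v₁}} {N : SymmMulticat.{u₂, v₂}} (F : Functor M N) :
    MultiNat (fun _ : Unit => F) F where
  app A := N.ident (F.obj A)
  natural {μ} _ {A} {B} f := by
    have h1 := N.ident_comp (F.map f)
    have h2 := N.comp_ident (F.map f)
    let D : (Σ _ : μ, Unit) → N.Obj := fun p => F.obj (A p.1)
    let σ := (IndexEquiv.sigmaUnit μ).symm
    calc
      _ = N.act σ (A := D) (N.act (IndexEquiv.sigmaUnit μ) (A := fun a => F.obj (A a))
            (N.comp (F.map f) fun a => N.ident (F.obj (A a)))) :=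
          ((N.act_act (IndexEquiv.sigmaUnit μ) σ (A := D) _).trans (N.act_refl (A := D) _)).symm
      _ = N.act σ (A := D) (N.act (IndexEquiv.unitSigma μ) (A := fun a => F.obj (A a))
            (N.comp (N.ident (F.obj B)) fun _ => F.map f)) :=
          congrArg (N.act σ (A := D)) (h2.trans h1.symm)
      _ = _ := N.act_act (IndexEquiv.unitSigma μ) σ (A := D) _

/-- Pointwise composition in `[M, N]`. -/
def MultiNat.comp {M : SymmMulticat.{u₁, v₁}} {N : SymmMulticat.{u₂, v₂}} {ι : Type} [Finite ι]
    {κ : ι → Type} [∀ i, Finite (κ i)] {H : ι → Functor M N} {G : Functor M N}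
    {F : ∀ i, κ i → Functor M N} (β : MultiNat H G) (α : ∀ i, MultiNat (F i) (H i)) :
    MultiNat (fun p : (Σ i, κ i) => F p.1 p.2) G where
  app A := N.comp (β.app A) (fun i => (α i).app A)
  natural {μ} _ {A} {B} f := by
    have e1 := N.assoc (G.map f) (fun a => β.app (A a)) (fun a i => (α i).app (A a))
    have e2 := N.act_comp (IndexEquiv.swap ι μ) (A := fun p => (H p.2).obj (A p.1))
      (N.comp (β.app B) (fun i => (H i).map f)) (fun p => (α p.2).app (A p.1))
    have e3 := N.assoc (β.app B) (fun i => (H i).map f) (fun i a => (α i).app (A a))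
    have e4 := N.comp_act (fun i => IndexEquiv.swap (κ i) μ)
      (D := fun i p => (F i p.2).obj (A p.1)) (β.app B)
      (fun i => N.comp ((α i).app B) (fun j => (F i j).map f))
    have e5 := N.assoc (β.app B) (fun i => (α i).app B) (fun i j => (F i j).map f)
    let as1 := Equiv.sigmaAssoc fun (_ : μ) (i : ι) => κ i
    let as2 := Equiv.sigmaAssoc fun (i : ι) (_ : μ) => κ i
    let as3 := Equiv.sigmaAssoc fun (i : ι) (_ : κ i) => μ
    let bl := IndexEquiv.block (IndexEquiv.swap ι μ) fun j => κ j.2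
    let cr := Equiv.sigmaCongrRight fun i => IndexEquiv.swap (κ i) μ
    let D1 : (Σ _ : μ, Σ i, κ i) → N.Obj := fun q => (F q.2.1 q.2.2).obj (A q.1)
    let D2 : (Σ p : (Σ _ : μ, ι), κ p.2) → N.Obj := fun q => (F q.1.2 q.2).obj (A q.1.1)
    let D3 : (Σ p : (Σ _ : ι, μ), κ p.1) → N.Obj := fun q => (F q.1.1 q.2).obj (A q.1.2)
    let D4 : (Σ i, Σ _ : μ, κ i) → N.Obj := fun q => (F q.1 q.2.2).obj (A q.2.1)
    let D5 : (Σ i, Σ _ : κ i, μ) → N.Obj := fun q => (F q.1 q.2.1).obj (A q.2.2)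
    have e3' : N.comp (N.comp (β.app B) fun i => (H i).map f)
        (fun p => (α p.1).app (A p.2)) = N.act as2.symm (A := D3) (N.comp (β.app B) fun i =>
          N.comp ((H i).map f) fun a => (α i).app (A a)) :=
      ((N.act_refl (A := D3) _).symm.trans (N.act_act as2 as2.symm (A := D3) _).symm).trans
        (congrArg (N.act as2.symm (A := D3)) e3)
    have e6 : (fun i => N.comp ((H i).map f) fun a => (α i).app (A a)) = fun i =>
        N.act (IndexEquiv.swap (κ i) μ) (A := fun p => (F i p.2).obj (A p.1))
          (N.comp ((α i).app B) fun j => (F i j).map f) := funext fun i => (α i).natural f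
    calc
      _ = N.act as1 (A := D1) (N.comp (N.comp (G.map f) fun a => β.app (A a))
            fun p => (α p.2).app (A p.1)) := e1.symm
      _ = N.act as1 (A := D1) (N.comp (N.act (IndexEquiv.swap ι μ)
            (A := fun p => (H p.2).obj (A p.1)) (N.comp (β.app B) fun i => (H i).map f))
            fun p => (α p.2).app (A p.1)) := by rw [β.natural f]
      _ = N.act as1 (A := D1) (N.act bl (A := D2) (N.comp
            (N.comp (β.app B) fun i => (H i).map f) fun p => (α p.1).app (A p.2))) :=
          congrArg (N.act as1 (A := D1)) e2
      _ = N.act as1 (A := D1) (N.act bl (A := D2) (N.act as2.symm (A := D3)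
            (N.act cr (A := D4) (N.act as3 (A := D5)
              (N.comp (N.comp (β.app B) fun i => (α i).app B) fun p =>
                (F p.1 p.2).map f))))) := by
          refine congrArg (fun z => N.act as1 (A := D1) (N.act bl (A := D2) z)) ?_
          refine e3'.trans (congrArg (N.act as2.symm (A := D3)) ?_)
          rw [e6]
          exact e4.trans (congrArg (N.act cr (A := D4)) e5.symm)
      _ = _ := by
          refine (N.act_act bl as1 (A := D1) _).trans ?_
          refine (N.act_act as2.symm (bl.trans as1) (A := D1) _).trans ?_
          refine (N.act_act cr (as2.symm.trans (bl.trans as1)) (A := D1) _).trans ?_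
          exact N.act_act as3 (cr.trans (as2.symm.trans (bl.trans as1))) (A := D1) _

/-- The pointwise symmetric structure of `[M, N]`. -/
def MultiNat.act {M : SymmMulticat.{u₁, v₁}} {N : SymmMulticat.{u₂, v₂}} {ι κ : Type} [Finite ι]
    [Finite κ] (σ : ι ≃ κ) {F : κ → Functor M N} {G : Functor M N}
    (α : MultiNat (fun i => F (σ i)) G) : MultiNat F G where
  app A := N.act σ (A := fun j => (F j).obj A) (α.app A)
  natural {μ} _ {A} {B} f := by
    have e1 := N.comp_act (fun _ : μ => σ) (D := fun a j => (F j).obj (A a)) (G.map f)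
      (fun a => α.app (A a))
    have e2 := N.act_comp σ (A := fun j => (F j).obj B) (α.app B) (fun j => (F j).map f)
    let D1 : (Σ _ : μ, κ) → N.Obj := fun p => (F p.2).obj (A p.1)
    let D2 : (Σ _ : κ, μ) → N.Obj := fun p => (F p.1).obj (A p.2)
    let cr := Equiv.sigmaCongrRight fun _ : μ => σ
    let bl := IndexEquiv.block σ fun _ => μ
    let c := N.comp (α.app B) fun i => (F (σ i)).map f
    have e3 : N.act ((IndexEquiv.swap ι μ).trans cr) (A := D1) c =
        N.act (bl.trans (IndexEquiv.swap κ μ)) (A := D1) c :=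
      N.act_heq (σ := (IndexEquiv.swap ι μ).trans cr) (τ := bl.trans (IndexEquiv.swap κ μ))
        (Equiv.ext fun _ => rfl) (HEq.refl c)
    calc
      _ = N.act cr (A := D1) (N.comp (G.map f) fun a => α.app (A a)) := e1
      _ = N.act cr (A := D1) (N.act (IndexEquiv.swap ι μ) (A := fun p => (F (σ p.2)).obj (A p.1))
            (N.comp (α.app B) fun i => (F (σ i)).map f)) :=
          congrArg (N.act cr (A := D1)) (α.natural f)
      _ = N.act (IndexEquiv.swap κ μ) (A := D1) (N.act bl (A := D2)
            (N.comp (α.app B) fun i => (F (σ i)).map f)) :=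
          (N.act_act (IndexEquiv.swap ι μ) cr (A := D1) c).trans
            (e3.trans (N.act_act bl (IndexEquiv.swap κ μ) (A := D1) c).symm)
      _ = _ := congrArg (N.act (IndexEquiv.swap κ μ) (A := D1)) e2.symm

/-- The internal hom `[M, N]`: its objects are the functors `M → N`, and the composition and the
symmetric structure are defined pointwise. -/
def internalHom (M : SymmMulticat.{u₁, v₁}) (N : SymmMulticat.{u₂, v₂}) :
    SymmMulticat.{max 1 u₁ v₁ u₂ v₂, max u₁ v₂} where
  Obj := Functor M N
  Hom F G := MultiNat F G
  ident F := MultiNat.ident F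
  comp β α := MultiNat.comp β α
  act σ _ _ α := MultiNat.act σ α
  act_refl _ := MultiNat.ext' fun _ => N.act_refl _
  act_act σ τ _ _ _ := MultiNat.ext' fun _ => N.act_act σ τ _
  ident_comp _ := MultiNat.ext' fun _ => N.ident_comp _
  comp_ident _ := MultiNat.ext' fun _ => N.comp_ident _
  assoc f g h := MultiNat.ext' fun X =>
    N.assoc (f.app X) (fun i => (g i).app X) (fun i j => (h i j).app X)
  comp_act {_} _ {_ _} _ _ σ {_ _ D} f g := MultiNat.ext' fun X =>
    N.comp_act σ (D := fun i j => (D i j).obj X) (f.app X) (fun i => (g i).app X)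
  act_comp {_ _ _ _} σ {_} _ {A} {_ _} f g := MultiNat.ext' fun X =>
    N.act_comp σ (A := fun j => (A j).obj X) (f.app X) (fun j => (g j).app X)

/-- The full sub-multicategory of `M` on a family of objects. -/
def fullSub (M : SymmMulticat.{u, v}) {O : Type u₁} (S : O → M.Obj) : SymmMulticat.{u₁, v} where
  Obj := O
  Hom A B := M.Hom (fun i => S (A i)) (S B)
  ident A := M.ident (S A)
  comp f g := M.comp f g
  act σ A _ f := M.act σ (A := fun j => S (A j)) f
  act_refl f := M.act_refl f
  act_act σ τ A _ f := M.act_act σ τ (A := fun j => S (A j)) f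
  ident_comp f := M.ident_comp f
  comp_ident f := M.comp_ident f
  assoc f g h := M.assoc f g h
  comp_act σ _ _ D f g := M.comp_act σ (D := fun i j => S (D i j)) f g
  act_comp σ _ _ A _ _ f g := M.act_comp σ (A := fun j => S (A j)) f g

/-! ### Central monoids and central unital magmas -/

/-- The terminal multicategory `1▸`, i.e. `C▸` for the terminal category `C`; it has exactly one
`n`-ary arrow for every `n`. -/
def terminal : SymmMulticat.{0, 0} := sequential (Discrete Unit)

/-- The unique object of `1▸`. -/
def star : terminal.Obj := (⟨()⟩ : Discrete Unit)

/-- The center of `M`: the full sub-multicategory of `[M, M]` on the identity functor. -/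
def center (M : SymmMulticat.{u, v}) : SymmMulticat.{0, max u v} :=
  fullSub (internalHom M M) (fun _ : Unit => Functor.idFunctor M)

/-- `M` has a central monoid: a functor `1▸ → [M, M]` whose object is the identity functor, that
is, whose restriction along `1⁻ → 1▸` is the name `1⁻ → [M, M]` of the identity. -/
def HasCentralMonoid (M : SymmMulticat.{u, v}) : Prop :=
  ∃ F : Functor terminal (internalHom M M), F.obj star = Functor.idFunctor M

/-- Arities `0, 1`, used to form `m (e, id)`. -/
def arityLeft : Fin 2 → Type
  | 0 => Empty
  | 1 => Unit

/-- Arities `1, 0`, used to form `m (id, e)`. -/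
def arityRight : Fin 2 → Type
  | 0 => Unit
  | 1 => Empty

instance (i : Fin 2) : Finite (arityLeft i) :=
  match i with
  | 0 => inferInstanceAs (Finite Empty)
  | 1 => inferInstanceAs (Finite Unit)

instance (i : Fin 2) : Finite (arityRight i) :=
  match i with
  | 0 => inferInstanceAs (Finite Unit)
  | 1 => inferInstanceAs (Finite Empty)

/-- The bijection of the single input of `m (e, id)` with a point. -/
def arityLeftEquiv : (Σ i, arityLeft i) ≃ Unit where
  toFun _ := ()
  invFun _ := ⟨1, ()⟩
  left_inv := by
    rintro ⟨i, x⟩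
    fin_cases i
    · exact x.elim
    · rfl
  right_inv _ := rfl

/-- The bijection of the single input of `m (id, e)` with a point. -/
def arityRightEquiv : (Σ i, arityRight i) ≃ Unit where
  toFun _ := ()
  invFun _ := ⟨0, ()⟩
  left_inv := by
    rintro ⟨i, x⟩
    fin_cases i
    · rfl
    · exact x.elim
  right_inv _ := rfl

/-- The pair of arrows `(e, id)`. -/
def pairLeft (M : SymmMulticat.{u, v}) {X : M.Obj} (e : M.Hom (fun _ : Empty => X) X) :
    ∀ i : Fin 2, M.Hom (fun _ : arityLeft i => X) X
  | 0 => e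
  | 1 => M.ident X

/-- The pair of arrows `(id, e)`. -/
def pairRight (M : SymmMulticat.{u, v}) {X : M.Obj} (e : M.Hom (fun _ : Empty => X) X) :
    ∀ i : Fin 2, M.Hom (fun _ : arityRight i => X) X
  | 0 => M.ident X
  | 1 => e

/-- A unital magma on the object `X` of `M`: a binary arrow `mul : X, X → X` and a `0`-ary arrow
`one : → X` such that `mul (one, id) = id = mul (id, one)`. -/
structure UnitalMagma (M : SymmMulticat.{u, v}) (X : M.Obj) where
  /-- the unit -/
  one : M.Hom (fun _ : Empty => X) X
  /-- the multiplication -/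
  mul : M.Hom (fun _ : Fin 2 => X) X
  one_mul : M.act arityLeftEquiv (A := fun _ => X) (M.comp mul (M.pairLeft one)) = M.ident X
  mul_one : M.act arityRightEquiv (A := fun _ => X) (M.comp mul (M.pairRight one)) = M.ident X

/-- `M` has a central unital magma, i.e. there is a unital magma in the center of `M`. -/
def HasCentralUnitalMagma (M : SymmMulticat.{u, v}) : Prop :=
  Nonempty (UnitalMagma (center M) ())

/-- The forgetful functor `[1▸, M] → M` induced by `1⁻ → 1▸`: it sends a commutative monoid
`1▸ → M` to its underlying object. -/
def forget (M : SymmMulticat.{u, v}) : Functor (internalHom terminal M) M where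
  obj F := Functor.obj F star
  map α := MultiNat.app α star
  map_ident _ := rfl
  map_comp _ _ := rfl
  map_act _ _ _ _ := rfl

/-! ### The Boardman-Vogt tensor product -/

/-- Formal arrows of `M ⊗ N`, generated under identities, composition and the symmetric structure
by the arrows `f_X : ⟨A_1, X⟩, …, ⟨A_n, X⟩ → ⟨A, X⟩` and
`h_A : ⟨A, X_1⟩, …, ⟨A, X_m⟩ → ⟨A, X⟩`. -/
inductive TensorPre (M : SymmMulticat.{u₁, v₁}) (N : SymmMulticat.{u₂, v₂}) :
    ∀ {ι : Type} [Finite ι], (ι → M.Obj × N.Obj) → M.Obj × N.Obj →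
      Type (max 1 u₁ v₁ u₂ v₂)
  | left {ι : Type} [Finite ι] {A : ι → M.Obj} {B : M.Obj} (f : M.Hom A B) (X : N.Obj) :
      TensorPre M N (fun i => (A i, X)) (B, X)
  | right {ι : Type} [Finite ι] {X : ι → N.Obj} {Y : N.Obj} (A : M.Obj) (h : N.Hom X Y) :
      TensorPre M N (fun i => (A, X i)) (A, Y)
  | ident (P : M.Obj × N.Obj) : TensorPre M N (fun _ : Unit => P) P
  | comp {ι : Type} [Finite ι] {κ : ι → Type} [∀ i, Finite (κ i)] {P : ι → M.Obj × N.Obj}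
      {Q : M.Obj × N.Obj} {D : ∀ i, κ i → M.Obj × N.Obj} (f : TensorPre M N P Q)
      (g : ∀ i, TensorPre M N (D i) (P i)) :
      TensorPre M N (fun p : (Σ i, κ i) => D p.1 p.2) Q
  | act {ι κ : Type} [Finite ι] [Finite κ] (σ : ι ≃ κ) {P : κ → M.Obj × N.Obj}
      {Q : M.Obj × N.Obj} (f : TensorPre M N (fun i => P (σ i)) Q) : TensorPre M N P Q

/-- The relations between the formal arrows of `M ⊗ N`: the congruence generated by the axioms of
symmetric multicategories, the functoriality of `(-)_X : M → M ⊗ N` and `(-)_A : N → M ⊗ N`, and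
the relation `f_X(h_{A_1}, …, h_{A_n}) = σ h_A(f_{X_1}, …, f_{X_m})`. -/
inductive TensorRel (M : SymmMulticat.{u₁, v₁}) (N : SymmMulticat.{u₂, v₂}) :
    ∀ {ι : Type} [Finite ι] {P : ι → M.Obj × N.Obj} {Q : M.Obj × N.Obj},
      TensorPre M N P Q → TensorPre M N P Q → Prop
  -- equivalence relation
  | refl {ι : Type} [Finite ι] {P : ι → M.Obj × N.Obj} {Q : M.Obj × N.Obj}
      (f : TensorPre M N P Q) : TensorRel M N f f
  | symm {ι : Type} [Finite ι] {P : ι → M.Obj × N.Obj} {Q : M.Obj × N.Obj}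
      {f g : TensorPre M N P Q} : TensorRel M N f g → TensorRel M N g f
  | trans {ι : Type} [Finite ι] {P : ι → M.Obj × N.Obj} {Q : M.Obj × N.Obj}
      {f g h : TensorPre M N P Q} : TensorRel M N f g → TensorRel M N g h → TensorRel M N f h
  -- compatibility with the operations
  | comp_congr {ι : Type} [Finite ι] {κ : ι → Type} [∀ i, Finite (κ i)] {P : ι → M.Obj × N.Obj}
      {Q : M.Obj × N.Obj} {D : ∀ i, κ i → M.Obj × N.Obj} {f f' : TensorPre M N P Q}
      {g g' : ∀ i, TensorPre M N (D i) (P i)} :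
      TensorRel M N f f' → (∀ i, TensorRel M N (g i) (g' i)) →
        TensorRel M N (f.comp g) (f'.comp g')
  | act_congr {ι κ : Type} [Finite ι] [Finite κ] (σ : ι ≃ κ) {P : κ → M.Obj × N.Obj}
      {Q : M.Obj × N.Obj} {f g : TensorPre M N (fun i => P (σ i)) Q} :
      TensorRel M N f g →
        TensorRel M N (TensorPre.act σ (P := P) f) (TensorPre.act σ (P := P) g)
  -- axioms of symmetric multicategories
  | act_refl {ι : Type} [Finite ι] {P : ι → M.Obj × N.Obj} {Q : M.Obj × N.Obj}
      (f : TensorPre M N P Q) : TensorRel M N (TensorPre.act (Equiv.refl ι) (P := P) f) f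
  | act_act {ι κ μ : Type} [Finite ι] [Finite κ] [Finite μ] (σ : ι ≃ κ) (τ : κ ≃ μ)
      {P : μ → M.Obj × N.Obj} {Q : M.Obj × N.Obj}
      (f : TensorPre M N (fun i => P (τ (σ i))) Q) :
      TensorRel M N (TensorPre.act τ (P := P) (TensorPre.act σ (P := fun j => P (τ j)) f))
        (TensorPre.act (σ.trans τ) (P := P) f)
  | ident_comp {ι : Type} [Finite ι] {P : ι → M.Obj × N.Obj} {Q : M.Obj × N.Obj}
      (f : TensorPre M N P Q) :
      TensorRel M N (TensorPre.act (IndexEquiv.unitSigma ι) (P := P)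
        ((TensorPre.ident Q).comp (fun _ : Unit => f))) f
  | comp_ident {ι : Type} [Finite ι] {P : ι → M.Obj × N.Obj} {Q : M.Obj × N.Obj}
      (f : TensorPre M N P Q) :
      TensorRel M N (TensorPre.act (IndexEquiv.sigmaUnit ι) (P := P)
        (f.comp (fun i => TensorPre.ident (P i)))) f
  | assoc {ι : Type} [Finite ι] {κ : ι → Type} [∀ i, Finite (κ i)] {μ : ∀ i, κ i → Type}
      [∀ i j, Finite (μ i j)] {P : ι → M.Obj × N.Obj} {Q : M.Obj × N.Obj}
      {D : ∀ i, κ i → M.Obj × N.Obj} {E : ∀ i j, μ i j → M.Obj × N.Obj}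
      (f : TensorPre M N P Q) (g : ∀ i, TensorPre M N (D i) (P i))
      (h : ∀ i j, TensorPre M N (E i j) (D i j)) :
      TensorRel M N (TensorPre.act (Equiv.sigmaAssoc μ) (P := fun q => E q.1 q.2.1 q.2.2)
        ((f.comp g).comp (fun p => h p.1 p.2))) (f.comp (fun i => (g i).comp (h i)))
  | comp_act {ι : Type} [Finite ι] {κ κ' : ι → Type} [∀ i, Finite (κ i)] [∀ i, Finite (κ' i)]
      (σ : ∀ i, κ i ≃ κ' i) {P : ι → M.Obj × N.Obj} {Q : M.Obj × N.Obj}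
      {D : ∀ i, κ' i → M.Obj × N.Obj} (f : TensorPre M N P Q)
      (g : ∀ i, TensorPre M N (fun j => D i (σ i j)) (P i)) :
      TensorRel M N (f.comp (fun i => TensorPre.act (σ i) (P := D i) (g i)))
        (TensorPre.act (Equiv.sigmaCongrRight σ) (P := fun p => D p.1 p.2) (f.comp g))
  | act_comp {ι ι' : Type} [Finite ι] [Finite ι'] (σ : ι ≃ ι') {κ : ι' → Type}
      [∀ j, Finite (κ j)] {P : ι' → M.Obj × N.Obj} {Q : M.Obj × N.Obj}
      {D : ∀ j, κ j → M.Obj × N.Obj} (f : TensorPre M N (fun i => P (σ i)) Q)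
      (g : ∀ j, TensorPre M N (D j) (P j)) :
      TensorRel M N ((TensorPre.act σ (P := P) f).comp g)
        (TensorPre.act (IndexEquiv.block σ κ) (P := fun p => D p.1 p.2)
          (f.comp (fun i => g (σ i))))
  -- functoriality of `(-)_X : M → M ⊗ N`
  | left_ident (A : M.Obj) (X : N.Obj) :
      TensorRel M N (TensorPre.left (M.ident A) X) (TensorPre.ident (A, X))
  | left_comp {ι : Type} [Finite ι] {κ : ι → Type} [∀ i, Finite (κ i)] {A : ι → M.Obj}
      {B : M.Obj} {D : ∀ i, κ i → M.Obj} (f : M.Hom A B) (g : ∀ i, M.Hom (D i) (A i))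
      (X : N.Obj) :
      TensorRel M N (TensorPre.left (M.comp f g) X)
        ((TensorPre.left f X).comp (fun i => TensorPre.left (g i) X))
  | left_act {ι κ : Type} [Finite ι] [Finite κ] (σ : ι ≃ κ) {A : κ → M.Obj} {B : M.Obj}
      (f : M.Hom (fun i => A (σ i)) B) (X : N.Obj) :
      TensorRel M N (TensorPre.left (M.act σ (A := A) f) X)
        (TensorPre.act σ (P := fun j => (A j, X)) (TensorPre.left f X))
  -- functoriality of `(-)_A : N → M ⊗ N`
  | right_ident (A : M.Obj) (X : N.Obj) :
      TensorRel M N (TensorPre.right A (N.ident X)) (TensorPre.ident (A, X))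
  | right_comp {ι : Type} [Finite ι] {κ : ι → Type} [∀ i, Finite (κ i)] {X : ι → N.Obj}
      {Y : N.Obj} {D : ∀ i, κ i → N.Obj} (A : M.Obj) (f : N.Hom X Y)
      (g : ∀ i, N.Hom (D i) (X i)) :
      TensorRel M N (TensorPre.right A (N.comp f g))
        ((TensorPre.right A f).comp (fun i => TensorPre.right A (g i)))
  | right_act {ι κ : Type} [Finite ι] [Finite κ] (σ : ι ≃ κ) {X : κ → N.Obj} {Y : N.Obj}
      (A : M.Obj) (f : N.Hom (fun i => X (σ i)) Y) :
      TensorRel M N (TensorPre.right A (N.act σ (A := X) f))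
        (TensorPre.act σ (P := fun j => (A, X j)) (TensorPre.right A f))
  -- the commuting relation
  | interchange {ι κ : Type} [Finite ι] [Finite κ] {A : ι → M.Obj} {B : M.Obj} {X : κ → N.Obj}
      {Y : N.Obj} (f : M.Hom A B) (h : N.Hom X Y) :
      TensorRel M N ((TensorPre.left f Y).comp (fun i => TensorPre.right (A i) h))
        (TensorPre.act (IndexEquiv.swap κ ι) (P := fun p => (A p.1, X p.2))
          ((TensorPre.right B h).comp (fun j => TensorPre.left f (X j))))

/-- The setoid of formal arrows of `M ⊗ N` modulo the relations. -/
def tensorSetoid (M : SymmMulticat.{u₁, v₁}) (N : SymmMulticat.{u₂, v₂}) {ι : Type} [Finite ι]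
    (P : ι → M.Obj × N.Obj) (Q : M.Obj × N.Obj) : Setoid (TensorPre M N P Q) where
  r f g := TensorRel M N f g
  iseqv := ⟨TensorRel.refl, TensorRel.symm, TensorRel.trans⟩

/-- The arrows of `M ⊗ N`. -/
def TensorHom (M : SymmMulticat.{u₁, v₁}) (N : SymmMulticat.{u₂, v₂}) {ι : Type} [Finite ι]
    (P : ι → M.Obj × N.Obj) (Q : M.Obj × N.Obj) : Type (max 1 u₁ v₁ u₂ v₂) :=
  Quotient (tensorSetoid M N P Q)

/-- The class of a formal arrow. -/
def TensorHom.mk {M : SymmMulticat.{u₁, v₁}} {N : SymmMulticat.{u₂, v₂}} {ι : Type} [Finite ι]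
    {P : ι → M.Obj × N.Obj} {Q : M.Obj × N.Obj} (f : TensorPre M N P Q) : TensorHom M N P Q :=
  Quotient.mk (tensorSetoid M N P Q) f

theorem TensorHom.sound {M : SymmMulticat.{u₁, v₁}} {N : SymmMulticat.{u₂, v₂}} {ι : Type}
    [Finite ι] {P : ι → M.Obj × N.Obj} {Q : M.Obj × N.Obj} {f g : TensorPre M N P Q}
    (h : TensorRel M N f g) : TensorHom.mk f = TensorHom.mk g :=
  Quotient.sound (s := tensorSetoid M N P Q) h

theorem TensorHom.exact {M : SymmMulticat.{u₁, v₁}} {N : SymmMulticat.{u₂, v₂}} {ι : Type}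
    [Finite ι] {P : ι → M.Obj × N.Obj} {Q : M.Obj × N.Obj} {f g : TensorPre M N P Q}
    (h : TensorHom.mk f = TensorHom.mk g) : TensorRel M N f g :=
  Quotient.exact (s := tensorSetoid M N P Q) h

theorem TensorHom.exists_rep {M : SymmMulticat.{u₁, v₁}} {N : SymmMulticat.{u₂, v₂}} {ι : Type}
    [Finite ι] {P : ι → M.Obj × N.Obj} {Q : M.Obj × N.Obj} (f : TensorHom M N P Q) :
    ∃ f' : TensorPre M N P Q, TensorHom.mk f' = f :=
  Quotient.exists_rep f

/-- Composition in `M ⊗ N`, induced by the formal composition. -/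
noncomputable def TensorHom.comp {M : SymmMulticat.{u₁, v₁}} {N : SymmMulticat.{u₂, v₂}}
    {ι : Type} [Finite ι] {κ : ι → Type} [∀ i, Finite (κ i)] {P : ι → M.Obj × N.Obj}
    {Q : M.Obj × N.Obj} {D : ∀ i, κ i → M.Obj × N.Obj} (f : TensorHom M N P Q)
    (g : ∀ i, TensorHom M N (D i) (P i)) :
    TensorHom M N (fun p : (Σ i, κ i) => D p.1 p.2) Q :=
  TensorHom.mk ((Quotient.out f).comp (fun i => Quotient.out (g i)))

theorem TensorHom.comp_mk {M : SymmMulticat.{u₁, v₁}} {N : SymmMulticat.{u₂, v₂}}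
    {ι : Type} [Finite ι] {κ : ι → Type} [∀ i, Finite (κ i)] {P : ι → M.Obj × N.Obj}
    {Q : M.Obj × N.Obj} {D : ∀ i, κ i → M.Obj × N.Obj} (f : TensorPre M N P Q)
    (g : ∀ i, TensorPre M N (D i) (P i)) :
    TensorHom.comp (TensorHom.mk f) (fun i => TensorHom.mk (g i)) = TensorHom.mk (f.comp g) :=
  TensorHom.sound (TensorRel.comp_congr (TensorHom.exact (Quotient.out_eq _))
    (fun _ => TensorHom.exact (Quotient.out_eq _)))

/-- The symmetric structure of `M ⊗ N`, induced by the formal one. -/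
def TensorHom.act {M : SymmMulticat.{u₁, v₁}} {N : SymmMulticat.{u₂, v₂}} {ι κ : Type}
    [Finite ι] [Finite κ] (σ : ι ≃ κ) {P : κ → M.Obj × N.Obj} {Q : M.Obj × N.Obj}
    (f : TensorHom M N (fun i => P (σ i)) Q) : TensorHom M N P Q :=
  Quotient.map (sa := tensorSetoid M N (fun i => P (σ i)) Q) (sb := tensorSetoid M N P Q)
    (fun f' => TensorPre.act σ (P := P) f') (fun _ _ h => TensorRel.act_congr σ h) f

/-- The Boardman-Vogt tensor product `M ⊗ N`. -/
noncomputable def tensor (M : SymmMulticat.{u₁, v₁}) (N : SymmMulticat.{u₂, v₂}) :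
    SymmMulticat.{max u₁ u₂, max 1 u₁ v₁ u₂ v₂} where
  Obj := M.Obj × N.Obj
  Hom P Q := TensorHom M N P Q
  ident P := TensorHom.mk (TensorPre.ident P)
  comp f g := TensorHom.comp f g
  act σ _ _ f := TensorHom.act σ f
  act_refl f := by
    obtain ⟨f, rfl⟩ := f.exists_rep
    exact TensorHom.sound (TensorRel.act_refl f)
  act_act σ τ _ _ f := by
    obtain ⟨f, rfl⟩ := f.exists_rep
    exact TensorHom.sound (TensorRel.act_act σ τ f)
  ident_comp f := by
    obtain ⟨f, rfl⟩ := f.exists_rep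
    rw [TensorHom.comp_mk]
    exact TensorHom.sound (TensorRel.ident_comp f)
  comp_ident f := by
    obtain ⟨f, rfl⟩ := f.exists_rep
    rw [TensorHom.comp_mk]
    exact TensorHom.sound (TensorRel.comp_ident f)
  assoc f g h := by
    obtain ⟨f, rfl⟩ := f.exists_rep
    choose g' hg using fun i => (g i).exists_rep
    obtain rfl : (fun i => TensorHom.mk (g' i)) = g := funext hg
    choose h' hh using fun i j => (h i j).exists_rep
    obtain rfl : (fun i j => TensorHom.mk (h' i j)) = h := funext fun i => funext (hh i)
    simp only [TensorHom.comp_mk]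
    exact TensorHom.sound (TensorRel.assoc f g' h')
  comp_act σ _ _ _ f g := by
    obtain ⟨f, rfl⟩ := f.exists_rep
    choose g' hg using fun i => (g i).exists_rep
    obtain rfl : (fun i => TensorHom.mk (g' i)) = g := funext hg
    rw [TensorHom.comp_mk]
    exact (TensorHom.comp_mk f _).trans (TensorHom.sound (TensorRel.comp_act σ f g'))
  act_comp σ _ _ _ _ _ f g := by
    obtain ⟨f, rfl⟩ := f.exists_rep
    choose g' hg using fun i => (g i).exists_rep
    obtain rfl : (fun i => TensorHom.mk (g' i)) = g := funext hg
    rw [TensorHom.comp_mk f (fun i => g' (σ i))]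
    exact (TensorHom.comp_mk _ g').trans (TensorHom.sound (TensorRel.act_comp σ f g'))

/-- The canonical functor `M → 1▸ ⊗ M` induced by `1⁻ → 1▸`: it sends `f` to `f_⋆`. -/
noncomputable def toTensor (M : SymmMulticat.{u, v}) : Functor M (tensor terminal M) where
  obj A := (star, A)
  map f := TensorHom.mk (TensorPre.right star f)
  map_ident A := TensorHom.sound (TensorRel.right_ident star A)
  map_comp f g := (TensorHom.sound (TensorRel.right_comp star f g)).trans
    (TensorHom.comp_mk _ _).symm
  map_act σ _ _ f := TensorHom.sound (TensorRel.right_act σ star f)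

end SymmMulticat

/-! The heart of the matter is an Eckmann–Hilton argument. Let `e` and `μ` form a central unital
magma. Iterating `μ` gives, for every finite arity, a central arrow `m` that becomes the identity
when `e` is inserted in all inputs but one. For `f : A_1, …, A_n → B` let `s_i : A_i → B` be `f`
with units in all inputs but the `i`-th. Centrality says that `f(m, …, m)` is `m(f, …, f)`
transposed. Filling the `n × n` array of inputs with identities on the diagonal and units elsewhere
turns the left side into `f` and the right side into `m(s_1, …, s_n)`. Hence `f ↦ (s_i)` is a
bijection with inverse `(s_i) ↦ m(s_1, …, s_n)`; it respects composition since `f(e, …, e) = e`.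
This proves 4 → 2 (`eq_act_comp_of_interchange`, `slot_comp`, `HasCentralUnitalMagma.isomorphic`).
Neither associativity nor commutativity of `μ` is assumed.

Central monoids arise from 1, 5 and 6 by moving a functor into `1▸ → [M, M]`: identities in `C▸`,
the transpose of a section of `forget M`, or the canonical `1▸ → [M, 1▸ ⊗ M]` followed by a
retraction of `toTensor M`.

For 1 → 5, a functor `1▸ → C▸` sends every arrow to a family of identities
(`Functor.map_terminal_eq_id`), so it amounts to an object. For 3 → 6, the central monoid induces a
retraction of `toTensor M`. It also gives a monoid structure on each `⟨⋆, X⟩` that commutes with the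
one coming from `1▸`; by Eckmann–Hilton the two coincide, so every arrow of `1▸ ⊗ M` comes from `M`.

Bookkeeping of index sets is handled by `Rel` (equality along a given bijection) and `Sim` (along
some bijection). -/

namespace SymmMulticat

/-! ### Arrows up to reindexing -/

/-- `Rel M σ f g` says that `g` is `f` reindexed along `σ`; the objects of the domains and the
codomains only have to agree up to propositional equality. -/
inductive Rel (M : SymmMulticat.{u, v}) {ι κ : Type} [Finite ι] [Finite κ] (σ : ι ≃ κ)
    {A' : κ → M.Obj} {B' : M.Obj} :
    ∀ {A : ι → M.Obj} {B : M.Obj}, M.Hom A B → M.Hom A' B' → Prop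
  | mk (f : M.Hom (fun i => A' (σ i)) B') : Rel M σ f (M.act σ (A := A') f)

namespace Rel

variable {M : SymmMulticat.{u, v}} {ι κ μ : Type} [Finite ι] [Finite κ] [Finite μ]

theorem eq_act {σ : ι ≃ κ} {A : κ → M.Obj} {B : M.Obj} {f : M.Hom (fun i => A (σ i)) B}
    {g : M.Hom A B} (h : Rel M σ f g) : g = M.act σ (A := A) f := by
  cases h
  rfl

theorem dom_eq {σ : ι ≃ κ} {A : ι → M.Obj} {A' : κ → M.Obj} {B B' : M.Obj} {f : M.Hom A B}
    {g : M.Hom A' B'} (h : Rel M σ f g) : A = fun i => A' (σ i) := by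
  cases h
  rfl

protected theorem refl {A : ι → M.Obj} {B : M.Obj} (f : M.Hom A B) :
    Rel M (Equiv.refl ι) f f := by
  have h := Rel.mk (M := M) (σ := Equiv.refl ι) (A' := A) f
  rwa [M.act_refl] at h

theorem eq_of_refl {A : ι → M.Obj} {B : M.Obj} {f g : M.Hom A B}
    (h : Rel M (Equiv.refl ι) f g) : f = g :=
  ((eq_act (σ := Equiv.refl ι) h).trans (M.act_refl f)).symm

protected theorem trans {σ : ι ≃ κ} {τ : κ ≃ μ} {A : ι → M.Obj} {A' : κ → M.Obj}
    {A'' : μ → M.Obj} {B B' B'' : M.Obj} {f : M.Hom A B} {g : M.Hom A' B'} {h : M.Hom A'' B''}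
    (h₁ : Rel M σ f g) (h₂ : Rel M τ g h) : Rel M (σ.trans τ) f h := by
  cases h₂
  cases h₁
  rw [M.act_act]
  exact Rel.mk (σ := σ.trans τ) _

theorem congr_equiv {σ τ : ι ≃ κ} {A : ι → M.Obj} {A' : κ → M.Obj}
    {B B' : M.Obj} {f : M.Hom A B} {g : M.Hom A' B'}
    (h : Rel M σ f g) (hσ : ∀ i, σ i = τ i) : Rel M τ f g := by
  obtain rfl : σ = τ := Equiv.ext hσ
  exact h

theorem eq_of_rel {σ : ι ≃ ι} {A : ι → M.Obj} {B : M.Obj} {f g : M.Hom A B}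
    (h : Rel M σ f g) (hσ : ∀ i, σ i = i) : f = g :=
  (h.congr_equiv (τ := Equiv.refl ι) hσ).eq_of_refl

theorem comp_right {κ κ' : ι → Type} [∀ i, Finite (κ i)] [∀ i, Finite (κ' i)]
    (τ : ∀ i, κ i ≃ κ' i) {A : ι → M.Obj} {B : M.Obj} {D : ∀ i, κ i → M.Obj}
    {D' : ∀ i, κ' i → M.Obj} (f : M.Hom A B) {g : ∀ i, M.Hom (D i) (A i)}
    {g' : ∀ i, M.Hom (D' i) (A i)} (h : ∀ i, Rel M (τ i) (g i) (g' i)) :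
    Rel M (Equiv.sigmaCongrRight τ) (M.comp f g) (M.comp f g') := by
  obtain rfl : D = fun i j => D' i (τ i j) := funext fun i => (h i).dom_eq
  obtain rfl : g' = fun i => M.act (τ i) (A := D' i) (g i) := funext fun i => (h i).eq_act
  rw [M.comp_act τ (D := D') f g]
  exact Rel.mk (σ := Equiv.sigmaCongrRight τ) (A' := fun p => D' p.1 p.2) _

protected theorem comp {ι' : Type} [Finite ι'] {σ : ι ≃ ι'} {κ : ι → Type} {κ' : ι' → Type}
    [∀ i, Finite (κ i)] [∀ i, Finite (κ' i)] {τ : ∀ i, κ i ≃ κ' (σ i)}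
    {A : ι → M.Obj} {B : M.Obj} {A' : ι' → M.Obj} {B' : M.Obj}
    {D : ∀ i, κ i → M.Obj} {D' : ∀ i, κ' i → M.Obj} {f : M.Hom A B} {f' : M.Hom A' B'}
    {g : ∀ i, M.Hom (D i) (A i)} {g' : ∀ i, M.Hom (D' i) (A' i)}
    (hf : Rel M σ f f') (h : ∀ i, Rel M (τ i) (g i) (g' (σ i))) :
    Rel M ((Equiv.sigmaCongrRight τ).trans (IndexEquiv.block σ κ')) (M.comp f g)
      (M.comp f' g') := by
  cases hf
  rw [M.act_comp σ]
  exact (comp_right τ f h).trans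
    (Rel.mk (σ := IndexEquiv.block σ κ') (A' := fun p => D' p.1 p.2) _)

theorem ident_comp {A : ι → M.Obj} {B : M.Obj} (f : M.Hom A B) :
    Rel M (IndexEquiv.unitSigma ι) (M.comp (M.ident B) (fun _ : Unit => f)) f := by
  have h := Rel.mk (σ := IndexEquiv.unitSigma ι) (A' := A) (M.comp (M.ident B) (fun _ : Unit => f))
  rwa [M.ident_comp] at h

theorem comp_ident {A : ι → M.Obj} {B : M.Obj} (f : M.Hom A B) :
    Rel M (IndexEquiv.sigmaUnit ι) (M.comp f (fun i => M.ident (A i))) f := by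
  have h := Rel.mk (σ := IndexEquiv.sigmaUnit ι) (A' := A) (M.comp f (fun i => M.ident (A i)))
  rwa [M.comp_ident] at h

theorem assoc {κ : ι → Type} [∀ i, Finite (κ i)]
    {μ : ∀ i, κ i → Type} [∀ i j, Finite (μ i j)] {A : ι → M.Obj} {B : M.Obj}
    {D : ∀ i, κ i → M.Obj} {E : ∀ i j, μ i j → M.Obj}
    (f : M.Hom A B) (g : ∀ i, M.Hom (D i) (A i)) (h : ∀ i j, M.Hom (E i j) (D i j)) :
    Rel M (Equiv.sigmaAssoc μ) (M.comp (M.comp f g) (fun p => h p.1 p.2))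
      (M.comp f (fun i => M.comp (g i) (h i))) := by
  have := Rel.mk (σ := Equiv.sigmaAssoc μ) (A' := fun q => E q.1 q.2.1 q.2.2)
    (M.comp (M.comp f g) (fun p => h p.1 p.2))
  rwa [M.assoc] at this

theorem map {N : SymmMulticat.{u₁, v₁}} (F : Functor M N) {σ : ι ≃ κ} {A : ι → M.Obj}
    {A' : κ → M.Obj} {B B' : M.Obj} {f : M.Hom A B} {g : M.Hom A' B'}
    (h : Rel M σ f g) : Rel N σ (F.map f) (F.map g) := by
  cases h
  rw [F.map_act]
  exact Rel.mk (σ := σ) (A' := fun j => F.obj (A' j)) _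

/-- Stands in for a cast: the family `A` need only agree propositionally with the reindexed `A'`. -/
theorem exists_of_dom_eq (σ : ι ≃ κ) {A : ι → M.Obj} {A' : κ → M.Obj} {B : M.Obj}
    (hA : ∀ i, A i = A' (σ i)) (f : M.Hom A B) : ∃ g : M.Hom A' B, Rel M σ f g := by
  obtain rfl : A = fun i => A' (σ i) := funext hA
  exact ⟨_, Rel.mk f⟩

protected theorem symm {σ : ι ≃ κ} {A : ι → M.Obj} {A' : κ → M.Obj}
    {B B' : M.Obj} {f : M.Hom A B} {g : M.Hom A' B'}
    (h : Rel M σ f g) : Rel M σ.symm g f := by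
  cases h with
  | mk f =>
    obtain ⟨h, hh⟩ := exists_of_dom_eq σ.symm (A' := fun i => A' (σ i)) (by simp)
      (M.act σ (A := A') f)
    obtain rfl := ((Rel.mk f).trans hh).eq_of_rel (by simp)
    exact hh

end Rel

/-- Arrows agree up to some reindexing. -/
def Sim (M : SymmMulticat.{u, v}) {ι κ : Type} [Finite ι] [Finite κ] {A : ι → M.Obj}
    {A' : κ → M.Obj} {B B' : M.Obj} (f : M.Hom A B) (g : M.Hom A' B') : Prop :=
  ∃ σ : ι ≃ κ, Rel M σ f g

namespace Sim

variable {M : SymmMulticat.{u, v}} {ι κ μ : Type} [Finite ι] [Finite κ] [Finite μ]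

protected theorem refl {A : ι → M.Obj} {B : M.Obj} (f : M.Hom A B) : Sim M f f :=
  ⟨_, Rel.refl f⟩

protected theorem symm {A : ι → M.Obj} {A' : κ → M.Obj}
    {B B' : M.Obj} {f : M.Hom A B} {g : M.Hom A' B'} : Sim M f g → Sim M g f :=
  fun ⟨_, h⟩ => ⟨_, h.symm⟩

protected theorem trans {A : ι → M.Obj} {A' : κ → M.Obj} {A'' : μ → M.Obj} {B B' B'' : M.Obj}
    {f : M.Hom A B} {g : M.Hom A' B'} {h : M.Hom A'' B''} :
    Sim M f g → Sim M g h → Sim M f h :=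
  fun ⟨_, h₁⟩ ⟨_, h₂⟩ => ⟨_, h₁.trans h₂⟩

/-- A set with at most one element has no nontrivial permutation, so for nullary and unary arrows
`Sim` loses nothing. -/
theorem eq_of_subsingleton [Subsingleton ι] {A : ι → M.Obj} {B : M.Obj} {f g : M.Hom A B} :
    Sim M f g → f = g :=
  fun ⟨_, h⟩ => h.eq_of_rel fun _ => Subsingleton.elim _ _

theorem comp_right {κ κ' : ι → Type} [∀ i, Finite (κ i)] [∀ i, Finite (κ' i)]
    {A : ι → M.Obj} {B : M.Obj} {D : ∀ i, κ i → M.Obj}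
    {D' : ∀ i, κ' i → M.Obj} (f : M.Hom A B) {g : ∀ i, M.Hom (D i) (A i)}
    {g' : ∀ i, M.Hom (D' i) (A i)} (h : ∀ i, Sim M (g i) (g' i)) :
    Sim M (M.comp f g) (M.comp f g') := by
  choose τ hτ using h
  exact ⟨_, Rel.comp_right τ f hτ⟩

/-- The outer bijection stays explicit, since it decides which `g'` is compared with `g i`; the
inner ones may be forgotten. -/
protected theorem comp {ι' : Type} [Finite ι'] {σ : ι ≃ ι'} {κ : ι → Type} {κ' : ι' → Type}
    [∀ i, Finite (κ i)] [∀ i, Finite (κ' i)]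
    {A : ι → M.Obj} {B : M.Obj} {A' : ι' → M.Obj} {B' : M.Obj}
    {D : ∀ i, κ i → M.Obj} {D' : ∀ i, κ' i → M.Obj} {f : M.Hom A B} {f' : M.Hom A' B'}
    {g : ∀ i, M.Hom (D i) (A i)} {g' : ∀ i, M.Hom (D' i) (A' i)}
    (hf : Rel M σ f f') (h : ∀ i, Sim M (g i) (g' (σ i))) :
    Sim M (M.comp f g) (M.comp f' g') := by
  choose τ hτ using h
  exact ⟨_, hf.comp hτ⟩

theorem act (σ : ι ≃ κ) {A : κ → M.Obj} {B : M.Obj} (f : M.Hom (fun i => A (σ i)) B) :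
    Sim M f (M.act σ (A := A) f) :=
  ⟨_, Rel.mk f⟩

theorem map {N : SymmMulticat.{u₁, v₁}} (F : Functor M N) {A : ι → M.Obj}
    {A' : κ → M.Obj} {B B' : M.Obj} {f : M.Hom A B} {g : M.Hom A' B'} :
    Sim M f g → Sim N (F.map f) (F.map g) :=
  fun ⟨_, h⟩ => ⟨_, h.map F⟩

/-- Over an empty index set the family `g` may be replaced by identities, and the unit law applies.
-/
theorem comp_of_isEmpty [IsEmpty ι] {κ : ι → Type} [∀ i, Finite (κ i)] {A : ι → M.Obj}
    {B : M.Obj} {D : ∀ i, κ i → M.Obj} (f : M.Hom A B) (g : ∀ i, M.Hom (D i) (A i)) :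
    Sim M (M.comp f g) f :=
  (comp_right f isEmptyElim).trans ⟨_, Rel.comp_ident f⟩

end Sim

/-! ### Inserting units -/

open Classical in
/-- The identity of `X` if `p` holds, and the nullary arrow `e` otherwise, as an arrow whose
domain is indexed by the proofs of `p`. -/
noncomputable def unitInsert (M : SymmMulticat.{u, v}) {X : M.Obj}
    (e : M.Hom (fun _ : Empty => X) X) (p : Prop) : M.Hom (fun _ : PLift p => X) X :=
  -- The two cases have different arities; indexing by `PLift p` gives them a common type, so a
  -- family with varying `p` can be inserted at once.
  if h : p then M.act (⟨fun _ => ⟨h⟩, fun _ => (), fun _ => rfl, fun _ => rfl⟩ : Unit ≃ PLift p)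
    (A := fun _ => X) (M.ident X)
  else M.act (⟨Empty.elim, fun q => (h q.down).elim, fun x => x.elim, fun q => (h q.down).elim⟩ :
    Empty ≃ PLift p) (A := fun _ => X) e

section unitInsert

variable {M : SymmMulticat.{u, v}} {X : M.Obj} (e : M.Hom (fun _ : Empty => X) X)

theorem sim_unitInsert_of_true {p : Prop} (h : p) : Sim M (M.unitInsert e p) (M.ident X) := by
  rw [unitInsert, dif_pos h]
  exact (Sim.act _ _).symm

theorem sim_unitInsert_of_false {p : Prop} (h : ¬p) : Sim M (M.unitInsert e p) e := by
  rw [unitInsert, dif_neg h]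
  exact (Sim.act _ _).symm

theorem sim_unitInsert_congr {p q : Prop} (h : p ↔ q) :
    Sim M (M.unitInsert e p) (M.unitInsert e q) := by
  obtain rfl := propext h
  exact Sim.refl _

theorem map_unitInsert {N : SymmMulticat.{u₁, v₁}} (F : Functor M N) (p : Prop) :
    F.map (M.unitInsert e p) = N.unitInsert (X := F.obj X) (F.map e) p := by
  unfold unitInsert
  split_ifs with h
  · rw [F.map_act, F.map_ident]
  · rw [F.map_act]

/-- An arrow `m : X, …, X → X` is unital with respect to `e : → X` if inserting `e` in all inputs
gives `e`, and inserting `e` in all inputs but one gives the identity. -/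
def IsUnital {ι : Type} [Finite ι] (m : M.Hom (fun _ : ι => X) X) : Prop :=
  ∀ p : ι → Prop, (∀ i j, p i → p j → i = j) →
    Sim M (M.comp m (fun i => M.unitInsert e (p i))) (M.unitInsert e (∃ i, p i))

namespace IsUnital

variable {e} {ι : Type} [Finite ι]

theorem sim_ident {m : M.Hom (fun _ : ι => X) X} (h : IsUnital e m) (i : ι) :
    Sim M (M.comp m (fun j => M.unitInsert e (i = j))) (M.ident X) :=
  (h (fun j => i = j) (fun _ _ h₁ h₂ => h₁.symm.trans h₂)).trans
    (sim_unitInsert_of_true e ⟨i, rfl⟩)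

/-- Both orientations of the equation are needed because Eckmann–Hilton reads the matrix of
propositions `i = j` by rows and by columns. -/
theorem sim_ident' {m : M.Hom (fun _ : ι => X) X} (h : IsUnital e m) (i : ι) :
    Sim M (M.comp m (fun j => M.unitInsert e (j = i))) (M.ident X) :=
  (h (fun j => j = i) (fun _ _ h₁ h₂ => h₁.trans h₂.symm)).trans
    (sim_unitInsert_of_true e ⟨i, rfl⟩)

theorem act {κ : Type} [Finite κ] (σ : ι ≃ κ) {m : M.Hom (fun _ : ι => X) X}
    (h : IsUnital e m) : IsUnital e (M.act σ (A := fun _ => X) m) := by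
  intro p hp
  have h₁ : Sim M (M.comp m (fun i => M.unitInsert e (p (σ i))))
      (M.comp (M.act σ (A := fun _ => X) m) (fun i => M.unitInsert e (p i))) :=
    Sim.comp (Rel.mk (σ := σ) (A' := fun _ => X) m) fun i => Sim.refl _
  refine h₁.symm.trans ((h _ fun i j hi hj => σ.injective (hp _ _ hi hj)).trans ?_)
  exact sim_unitInsert_congr e (σ.surjective.exists (p := p)).symm

theorem ident : IsUnital e (M.ident X) := by
  intro p hp
  exact (Sim.trans ⟨_, Rel.ident_comp (M.unitInsert e (p ()))⟩
    (sim_unitInsert_congr e ⟨fun h => ⟨(), h⟩, fun ⟨_, h⟩ => h⟩))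

/-- At most one block contains an input where `p` holds. Unitality of `n i` collapses block `i` to a
single insertion that records whether it contains such an input, and unitality of `m` finishes. -/
theorem comp {κ : ι → Type} [∀ i, Finite (κ i)] {m : M.Hom (fun _ : ι => X) X}
    {n : ∀ i, M.Hom (fun _ : κ i => X) X} (hm : IsUnital e m) (hn : ∀ i, IsUnital e (n i)) :
    IsUnital e (M.comp m n) := by
  intro p hp
  refine Sim.trans ⟨_, Rel.assoc m n fun i j => M.unitInsert e (p ⟨i, j⟩)⟩ ?_
  refine (Sim.comp_right m fun i => hn i (fun j => p ⟨i, j⟩) ?_).trans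
    ((hm (fun i => ∃ j, p ⟨i, j⟩) ?_).trans (sim_unitInsert_congr e Sigma.exists.symm))
  · intro j j' hj hj'
    simpa using hp _ _ hj hj'
  · rintro i i' ⟨j, hj⟩ ⟨j', hj'⟩
    exact congrArg Sigma.fst (hp _ _ hj hj')

theorem of_isEmpty (σ : Empty ≃ ι) : IsUnital e (M.act σ (A := fun _ => X) e) := by
  refine act σ fun p hp => (Sim.comp_of_isEmpty e _).trans ?_
  exact (sim_unitInsert_of_false e (by simp)).symm

theorem map {N : SymmMulticat.{u₁, v₁}} (F : Functor M N) {m : M.Hom (fun _ : ι => X) X}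
    (h : IsUnital e m) : IsUnital (M := N) (X := F.obj X) (F.map e) (F.map m) := by
  intro p hp
  have := (h p hp).map F
  rw [F.map_comp] at this
  simpa only [map_unitInsert] using this

end IsUnital

theorem UnitalMagma.isUnital_mul (m : UnitalMagma M X) : IsUnital m.one m.mul := by
  have h₁ : Sim M (M.comp m.mul (M.pairLeft m.one)) (M.ident X) := by
    rw [← m.one_mul]
    exact Sim.act arityLeftEquiv (A := fun _ => X) _
  have h₂ : Sim M (M.comp m.mul (M.pairRight m.one)) (M.ident X) := by
    rw [← m.mul_one]
    exact Sim.act arityRightEquiv (A := fun _ => X) _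
  intro p hp
  by_cases h0 : p 0
  · have h1 : ¬p 1 := fun h1 => absurd (hp 0 1 h0 h1) (by decide)
    refine Sim.trans (Sim.comp_right m.mul (g' := M.pairRight m.one) fun i => ?_)
      (h₂.trans (sim_unitInsert_of_true _ ⟨0, h0⟩).symm)
    match i with
    | 0 => exact sim_unitInsert_of_true _ h0
    | 1 => exact sim_unitInsert_of_false _ h1
  by_cases h1 : p 1
  · refine Sim.trans (Sim.comp_right m.mul (g' := M.pairLeft m.one) fun i => ?_)
      (h₁.trans (sim_unitInsert_of_true _ ⟨1, h1⟩).symm)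
    match i with
    | 0 => exact sim_unitInsert_of_false _ h0
    | 1 => exact sim_unitInsert_of_true _ h1
  -- That `μ(e, e)` is `e` is not an axiom; it follows by putting `e` into the remaining input of
  -- `μ(e, id) = id`.
  · have h₃ : Sim M (M.comp (M.comp m.mul (M.pairLeft m.one)) fun _ => m.one) m.one := by
      obtain ⟨σ, hσ⟩ := h₁
      exact (Sim.comp hσ (g' := fun _ => m.one) fun _ => Sim.refl _).trans
        ⟨_, Rel.ident_comp m.one⟩
    refine Sim.trans ?_ (h₃.trans
      (sim_unitInsert_of_false _ (by simp [Fin.exists_fin_two, *])).symm)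
    refine Sim.trans ?_ (Sim.symm ⟨_, Rel.assoc m.mul (M.pairLeft m.one) fun _ _ => m.one⟩)
    refine Sim.comp_right m.mul fun i => ?_
    match i with
    | 0 => exact (sim_unitInsert_of_false _ h0).trans (Sim.comp_of_isEmpty (ι := Empty) _ _).symm
    | 1 => exact (sim_unitInsert_of_false _ h1).trans (Sim.symm ⟨_, Rel.ident_comp m.one⟩)

/-- The index sets `ι` and `{⋆}`. -/
def optionArity (ι : Type) : Fin 2 → Type
  | 0 => ι
  | 1 => Unit

instance optionArity.finite (ι : Type) [Finite ι] (b : Fin 2) : Finite (optionArity ι b) :=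
  match b with
  | 0 => inferInstanceAs (Finite ι)
  | 1 => inferInstanceAs (Finite Unit)

/-- The bijection `ι ⨿ {⋆} ≃ Option ι`. -/
def optionArityEquiv (ι : Type) : (Σ b, optionArity ι b) ≃ Option ι where
  toFun
    | ⟨0, i⟩ => some i
    | ⟨1, _⟩ => none
  invFun
    | some i => ⟨0, i⟩
    | none => ⟨1, ()⟩
  left_inv
    | ⟨0, _⟩ => rfl
    | ⟨1, _⟩ => rfl
  right_inv
    | some _ => rfl
    | none => rfl

/-- Iterated multiplication: `e` in arity zero, and `μ(n, id)` to add one input to `n`. -/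
theorem UnitalMagma.exists_isUnital (m : UnitalMagma M X) (ι : Type) [Finite ι] :
    ∃ n : M.Hom (fun _ : ι => X) X, IsUnital m.one n := by
  -- Arrows indexed by `ι` only make sense for finite `ι`, so the motive carries finiteness along;
  -- by proof irrelevance it is the given instance.
  refine Finite.induction_empty_option
    (P := fun ι => ∃ _ : Finite ι, ∃ n : M.Hom (fun _ : ι => X) X, IsUnital m.one n)
    ?_ ?_ ?_ ι |>.2
  · rintro α β σ ⟨_, n, hn⟩
    exact ⟨.of_equiv α σ, by
      have := Finite.of_equiv α σ
      exact ⟨_, hn.act σ⟩⟩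
  · exact ⟨inferInstance, _, .of_isEmpty (Equiv.equivOfIsEmpty _ _)⟩
  · rintro α _ ⟨_, n, hn⟩
    let n' : ∀ b, M.Hom (fun _ : optionArity α b => X) X
      | 0 => n
      | 1 => M.ident X
    refine ⟨inferInstance, _, (m.isUnital_mul.comp (n := n') fun b => ?_).act (optionArityEquiv α)⟩
    match b with
    | 0 => exact hn
    | 1 => exact .ident

end unitInsert

/-! ### The Eckmann–Hilton argument -/

/-- An arrow `f` that commutes with unital arrows is determined by the unary arrows `s i`
obtained by inserting units in all inputs of `f` but the `i`-th. -/
theorem eq_act_comp_of_interchange (M : SymmMulticat.{u, v}) {ι : Type} [Finite ι] {A : ι → M.Obj}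
    {B : M.Obj} (f : M.Hom A B) {e : ∀ i, M.Hom (fun _ : Empty => A i) (A i)}
    {m : ∀ i, M.Hom (fun _ : ι => A i) (A i)} (hm : ∀ i, IsUnital (e i) (m i))
    {n : M.Hom (fun _ : ι => B) B}
    (hn : M.comp f m = M.act (IndexEquiv.swap ι ι) (A := fun p => A p.1) (M.comp n fun _ => f))
    {s : ∀ i, M.Hom (fun _ : Unit => A i) B}
    (hs : ∀ i, Sim M (M.comp f (fun j => M.unitInsert (e j) (i = j))) (s i)) :
    f = M.act (IndexEquiv.sigmaUnit ι) (A := A) (M.comp n s) := by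
  -- The array of insertions has the identity where `i = j` and a unit elsewhere. Grouped by the
  -- inputs `j` of `f` it reduces each `m j` to the identity (`τ`); grouped by the inputs `i` of `n`
  -- it reduces each copy of `f` to `s i` (`ρ`).
  choose τ hτ using fun j => (hm j).sim_ident' j
  choose ρ hρ using hs
  have r₁ := (Rel.comp_right τ f hτ).trans (Rel.comp_ident f)
  have r₂ := Rel.assoc f m fun j i => M.unitInsert (e j) (i = j)
  have r₃ := Rel.mk (σ := IndexEquiv.swap ι ι) (A' := fun p => A p.1) (M.comp n fun _ => f)
  rw [← hn] at r₃
  have r₄ := r₃.comp (g := fun q : Σ _ : ι, ι => M.unitInsert (e q.2) (q.1 = q.2))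
    (g' := fun q : Σ _ : ι, ι => M.unitInsert (e q.1) (q.2 = q.1)) fun q => Rel.refl _
  have r₅ := Rel.assoc n (fun _ => f) fun i j => M.unitInsert (e j) (i = j)
  have r₆ := Rel.comp_right ρ n hρ
  have r := r₆.symm.trans (r₅.symm.trans (r₄.trans (r₂.trans r₁)))
  refine Rel.eq_act (r.congr_equiv (τ := IndexEquiv.sigmaUnit ι) ?_)
  rintro ⟨i, ⟨⟩⟩
  -- It remains to identify the composite bijection. Although `ρ` and `τ` are unspecified, the only
  -- surviving input in row `i` is the diagonal one, so `⟨i, ()⟩` must go to `i`.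
  obtain ⟨⟨j, ⟨h⟩⟩, hj⟩ : ∃ p, p = (ρ i).symm () := ⟨_, rfl⟩
  subst h
  simp only [Equiv.trans_apply]
  have h₆ : (Equiv.sigmaCongrRight ρ).symm ⟨i, ()⟩ = ⟨i, i, ⟨rfl⟩⟩ :=
    congrArg (Sigma.mk i) hj.symm
  rw [h₆]
  rfl

/-! ### Isomorphisms of symmetric multicategories -/

namespace Functor

theorem ext_heq {M : SymmMulticat.{u₁, v₁}} {N : SymmMulticat.{u₂, v₂}} {F G : Functor M N}
    (hobj : ∀ A, F.obj A = G.obj A)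
    (hmap : ∀ {ι : Type} [Finite ι] {A : ι → M.Obj} {B : M.Obj} (f : M.Hom A B),
      F.map f ≍ G.map f) : F = G := by
  obtain ⟨obj, map, _, _, _⟩ := F
  obtain ⟨obj', map', _, _, _⟩ := G
  obtain rfl : obj = obj' := funext hobj
  congr
  funext ι _ A B f
  exact eq_of_heq (hmap f)

theorem map_heq {M : SymmMulticat.{u₁, v₁}} {N : SymmMulticat.{u₂, v₂}} {F G : Functor M N}
    (h : F = G) {ι : Type} [Finite ι] {A : ι → M.Obj} {B : M.Obj} (f : M.Hom A B) :
    F.map f ≍ G.map f := by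
  rw [h]

theorem map_injective_of_trans_eq {M : SymmMulticat.{u₁, v₁}} {N : SymmMulticat.{u₂, v₂}}
    {F : Functor M N} {G : Functor N M} (h : F.trans G = idFunctor M) {ι : Type} [Finite ι]
    (A : ι → M.Obj) (B : M.Obj) :
    Function.Injective (F.map : M.Hom A B → N.Hom (fun i => F.obj (A i)) (F.obj B)) := by
  intro f g hfg
  have hf := map_heq h f
  have hg := map_heq h g
  refine eq_of_heq (hf.symm.trans (HEq.trans (heq_of_eq ?_) hg))
  exact congrArg G.map hfg

end Functor

theorem comp_heq (M : SymmMulticat.{u, v}) {ι : Type} [Finite ι] {κ : ι → Type}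
    [∀ i, Finite (κ i)] {A A' : ι → M.Obj} {B B' : M.Obj} {D D' : ∀ i, κ i → M.Obj}
    (hA : A = A') (hB : B = B') (hD : D = D') {f : M.Hom A B} {f' : M.Hom A' B'}
    {g : ∀ i, M.Hom (D i) (A i)} {g' : ∀ i, M.Hom (D' i) (A' i)} (hf : f ≍ f')
    (hg : ∀ i, g i ≍ g' i) : M.comp f g ≍ M.comp f' g' := by
  subst hA hB hD
  obtain rfl := eq_of_heq hf
  obtain rfl : g = g' := funext fun i => eq_of_heq (hg i)
  rfl

theorem act_heq_act (M : SymmMulticat.{u, v}) {ι κ : Type} [Finite ι] [Finite κ] (σ : ι ≃ κ)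
    {A A' : κ → M.Obj} {B B' : M.Obj} (hA : A = A') (hB : B = B')
    {f : M.Hom (fun i => A (σ i)) B} {f' : M.Hom (fun i => A' (σ i)) B'} (hf : f ≍ f') :
    M.act σ (A := A) f ≍ M.act σ (A := A') f' := by
  subst hA hB
  obtain rfl := eq_of_heq hf
  rfl

/-- A functor that is bijective on objects and on arrows is an isomorphism. -/
theorem Functor.isIso_of_bijective {M : SymmMulticat.{u₁, v₁}} {N : SymmMulticat.{u₂, v₂}}
    (F : Functor M N) (hobj : Function.Bijective F.obj)
    (hmap : ∀ {ι : Type} [Finite ι] (A : ι → M.Obj) (B : M.Obj), Function.Bijective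
      (F.map : M.Hom A B → N.Hom (fun i => F.obj (A i)) (F.obj B))) : F.IsIso := by
  obtain ⟨g, hg, hg'⟩ := Function.bijective_iff_has_inverse.mp hobj
  -- Since `F.obj (g X) = X` is only propositional, preimages of arrows are characterised
  -- heterogeneously.
  have surj : ∀ {ι : Type} [Finite ι] {A : ι → N.Obj} {B : N.Obj} (h : N.Hom A B),
      ∃ f : M.Hom (fun i => g (A i)) (g B), F.map f ≍ h := by
    intro ι _ A B h
    have key : ∀ {A' : ι → N.Obj} {B' : N.Obj} (_ : A' = A) (_ : B' = B),
        ∃ h' : N.Hom A' B', h' ≍ h := by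
      rintro _ _ rfl rfl
      exact ⟨h, HEq.rfl⟩
    obtain ⟨h', hh⟩ := key (A' := fun i => F.obj (g (A i))) (B' := F.obj (g B))
      (funext fun i => hg' (A i)) (hg' B)
    obtain ⟨f, rfl⟩ := (hmap _ _).2 h'
    exact ⟨f, hh⟩
  -- Lets each functor law of the inverse be checked after applying `F`.
  have inj : ∀ {ι : Type} [Finite ι] {A A' : ι → M.Obj} {B B' : M.Obj} (f : M.Hom A B)
      (f' : M.Hom A' B'), A = A' → B = B' → F.map f ≍ F.map f' → f ≍ f' := by
    rintro ι _ A _ B _ f f' rfl rfl h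
    exact heq_of_eq ((hmap _ _).1 (eq_of_heq h))
  choose map hmap' using @surj
  let G : Functor N M :=
    { obj := g
      map := fun h => map h
      map_ident := fun A => eq_of_heq (inj _ _ rfl rfl (by
        refine (hmap' _).trans ?_
        rw [F.map_ident, hg']))
      map_comp := fun f h => eq_of_heq (inj _ _ rfl rfl (by
        refine (hmap' _).trans ?_
        rw [F.map_comp]
        exact N.comp_heq (funext fun _ => (hg' _).symm) (hg' _).symm
          (funext fun _ => funext fun _ => (hg' _).symm) (hmap' f).symm
          fun i => (hmap' (h i)).symm))
      map_act := fun σ A B f => eq_of_heq (inj _ _ rfl rfl (by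
        refine (hmap' _).trans ?_
        rw [F.map_act σ (A := fun j => g (A j))]
        exact N.act_heq_act σ (funext fun _ => (hg' _).symm) (hg' _).symm (hmap' f).symm)) }
  refine ⟨G, Functor.ext_heq hg fun f => ?_, Functor.ext_heq hg' fun f => hmap' f⟩
  exact inj _ _ (funext fun _ => hg _) (hg _) (hmap' (F.map f))

/-! ### Multicategories with a central unital magma -/

section slot

variable {M : SymmMulticat.{u, v}} (e : ∀ A : M.Obj, M.Hom (fun _ : Empty => A) A)

/-- The inputs left after the insertion are indexed by the `j` with `i = j`, a one-point set over
which `A j` is `A i`. -/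
theorem exists_sim_unitInsert {ι : Type} [Finite ι] {A : ι → M.Obj} {B : M.Obj} (f : M.Hom A B)
    (i : ι) : ∃ s : M.Hom (fun _ : Unit => A i) B,
      Sim M (M.comp f (fun j => M.unitInsert (e (A j)) (i = j))) s := by
  let σ : (Σ j, PLift (i = j)) ≃ Unit :=
    ⟨fun _ => (), fun _ => ⟨i, ⟨rfl⟩⟩, fun ⟨_, ⟨h⟩⟩ => by subst h; rfl, fun _ => rfl⟩
  obtain ⟨s, hs⟩ := Rel.exists_of_dom_eq σ (A' := fun _ => A i)
    (by rintro ⟨_, ⟨rfl⟩⟩; rfl) (M.comp f (fun j => M.unitInsert (e (A j)) (i = j)))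
  exact ⟨s, _, hs⟩

/-- The unary arrow obtained by inserting units in all inputs of `f` but the `i`-th. -/
noncomputable def slot {ι : Type} [Finite ι] {A : ι → M.Obj} {B : M.Obj} (f : M.Hom A B)
    (i : ι) : M.Hom (fun _ : Unit => A i) B :=
  (exists_sim_unitInsert e f i).choose

variable {e}

theorem sim_slot {ι : Type} [Finite ι] {A : ι → M.Obj} {B : M.Obj} (f : M.Hom A B) (i : ι) :
    Sim M (M.comp f (fun j => M.unitInsert (e (A j)) (i = j))) (slot e f i) :=
  (exists_sim_unitInsert e f i).choose_spec

/-- The choice in `slot` is harmless: a unary arrow is determined by its `Sim` class. -/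
theorem slot_eq {ι : Type} [Finite ι] {A : ι → M.Obj} {B : M.Obj} {f : M.Hom A B} {i : ι}
    {s : M.Hom (fun _ : Unit => A i) B}
    (h : Sim M (M.comp f (fun j => M.unitInsert (e (A j)) (i = j))) s) : slot e f i = s :=
  ((sim_slot f i).symm.trans h).eq_of_subsingleton

theorem slot_unary {A B : M.Obj} (f : M.Hom (fun _ : Unit => A) B) (i : Unit) :
    slot e f i = f :=
  slot_eq ((Sim.comp_right f fun _ => sim_unitInsert_of_true _ rfl).trans
    ⟨_, Rel.comp_ident f⟩)

theorem slot_act {ι κ : Type} [Finite ι] [Finite κ] (σ : ι ≃ κ) {A : κ → M.Obj} {B : M.Obj}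
    (f : M.Hom (fun i => A (σ i)) B) (i : ι) :
    slot e (M.act σ (A := A) f) (σ i) = slot e f i := by
  refine slot_eq (Sim.trans (Sim.symm ?_) (sim_slot f i))
  exact Sim.comp (Rel.mk f) fun j => sim_unitInsert_congr _ (by simp)

/-- Every `g j` with `j ≠ i` receives only units and collapses to the unit of `A j` by `he`, while
`g i` becomes its `k`-th slot; what remains is the `i`-th slot of `f`. -/
theorem slot_comp
    (he : ∀ {ι : Type} [Finite ι] {A : ι → M.Obj} {B : M.Obj} (f : M.Hom A B),
      Sim M (M.comp f (fun i => e (A i))) (e B))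
    {ι : Type} [Finite ι] {κ : ι → Type} [∀ i, Finite (κ i)] {A : ι → M.Obj} {B : M.Obj}
    {D : ∀ i, κ i → M.Obj} (f : M.Hom A B) (g : ∀ i, M.Hom (D i) (A i)) (i : ι) (k : κ i) :
    slot e (M.comp f g) ⟨i, k⟩ = M.unaryComp (slot e (g i) k) (slot e f i) := by
  refine slot_eq ?_
  refine Sim.trans ⟨_, Rel.assoc f g fun j l => M.unitInsert (e (D j l))
    (⟨i, k⟩ = Sigma.mk j l)⟩ ?_
  refine Sim.trans ?_ (Sim.act _ _)
  obtain ⟨σ, hσ⟩ := sim_slot (e := e) f i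
  -- The slot of `g i` written as a family over all `j`, vacuous unless `i = j`, so that it can be
  -- composed with the insertions into `f`.
  let x : ∀ (j : ι) (h : PLift (i = j)), M.Hom (fun _ : Unit => D j (h.down ▸ k)) (A j) :=
    fun j h => slot e (g j) (h.down ▸ k)
  have h₁ := Sim.comp hσ (g := fun p : Σ j, PLift (i = j) => x p.1 p.2)
    (g' := fun _ => slot e (g i) k) (by
    rintro ⟨j, ⟨rfl⟩⟩
    exact Sim.refl _)
  refine Sim.trans (Sim.trans ?_ (Sim.symm ⟨_, Rel.assoc f _ x⟩)) h₁
  refine Sim.comp_right f fun j => ?_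
  by_cases h : i = j
  · subst h
    obtain ⟨τ, hτ⟩ := sim_unitInsert_of_true (e (A i)) (rfl : i = i)
    have h₂ := (Sim.comp hτ (g := x i) (g' := fun _ => slot e (g i) k) fun _ => Sim.refl _).trans
      ⟨_, Rel.ident_comp _⟩
    refine Sim.trans ?_ h₂.symm
    refine Sim.trans (Sim.comp_right _ fun l => ?_) (sim_slot (g i) k)
    exact sim_unitInsert_congr _ (by simp)
  · have : IsEmpty (PLift (i = j)) := ⟨fun q => h q.down⟩
    refine Sim.trans (Sim.trans (Sim.comp_right _ fun l => ?_) (he (g j)))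
      ((Sim.comp_of_isEmpty _ _).trans (sim_unitInsert_of_false _ h)).symm
    exact sim_unitInsert_of_false _ fun hl => h (congrArg Sigma.fst hl)

end slot

/-- The functor `[M, N] → N` that evaluates at an object. -/
def evalAt (M : SymmMulticat.{u₁, v₁}) (N : SymmMulticat.{u₂, v₂}) (A : M.Obj) :
    Functor (internalHom M N) N where
  obj F := Functor.obj F A
  map α := MultiNat.app α A
  map_ident _ := rfl
  map_comp _ _ := rfl
  map_act _ _ _ _ := rfl

/-- The inclusion of a full sub-multicategory. -/
def fullSubInclusion (M : SymmMulticat.{u, v}) {O : Type u₁} (S : O → M.Obj) :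
    Functor (fullSub M S) M where
  obj := S
  map f := f
  map_ident _ := rfl
  map_comp _ _ := rfl
  map_act _ _ _ _ := rfl

/-- The functor from the center of `M` to `M` that evaluates at an object. -/
def centerEval (M : SymmMulticat.{u, v}) (A : M.Obj) : Functor (center M) M :=
  (fullSubInclusion _ _).trans (evalAt M M A)

/-- A multicategory with a central unital magma is isomorphic to `(M₋)▸`. -/
theorem HasCentralUnitalMagma.isomorphic {M : SymmMulticat.{u, v}}
    (h : M.HasCentralUnitalMagma) : Isomorphic M (sequential (Underlying M)) := by
  obtain ⟨m⟩ := h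
  let e (A : M.Obj) : M.Hom (fun _ : Empty => A) A := (centerEval M A).map m.one
  -- Centrality of the nullary arrow: after transposition the copies of `f` form an empty family.
  have he {ι : Type} [Finite ι] {A : ι → M.Obj} {B : M.Obj} (f : M.Hom A B) :
      Sim M (M.comp f (fun i => e (A i))) (e B) := by
    have h : M.comp f (fun i => e (A i)) = M.act (IndexEquiv.swap Empty ι) (A := fun p => A p.1)
        (M.comp (e B) fun _ => f) := MultiNat.natural m.one f
    rw [h]
    exact (Sim.act _ _).symm.trans (Sim.comp_of_isEmpty _ _)
  let Φ : Functor M (sequential (Underlying M)) :=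
    { obj := fun A => A
      map := fun f i => slot e f i
      map_ident := fun A => funext fun i => slot_unary _ _
      map_comp := fun f g => funext fun p => slot_comp he f g p.1 p.2
      map_act := fun σ A B f => (seqAct_eq (C := Underlying M) σ (A := A) (B := B) _ _
        fun i => (slot_act σ f i).symm).symm }
  refine ⟨Φ, Φ.isIso_of_bijective Function.bijective_id fun {ι} _ A B => ?_⟩
  -- The iterated multiplication is formed in the center, so its components commute with every arrow
  -- of `M`, and evaluation at an object keeps them unital.
  obtain ⟨n, hn⟩ := m.exists_isUnital ι
  let n' (A : M.Obj) : M.Hom (fun _ : ι => A) A := (centerEval M A).map n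
  have hn' (A : M.Obj) : IsUnital (e A) (n' A) := hn.map (centerEval M A)
  constructor
  · intro f g hfg
    have key (f : M.Hom A B) := M.eq_act_comp_of_interchange f (fun i => hn' (A i))
      (MultiNat.natural n f) (fun i => sim_slot (e := e) f i)
    rw [key f, key g]
    exact congrArg (fun s => M.act (IndexEquiv.sigmaUnit ι) (A := A) (M.comp (n' B) s)) hfg
  · intro (s : ∀ i, M.Hom (fun _ : Unit => A i) B)
    -- The preimage is the "sum" of the `s i`; its `i`-th slot is `s i` because every slot of `n' B`
    -- is an identity.
    refine ⟨M.act (IndexEquiv.sigmaUnit ι) (A := A) (M.comp (n' B) s), funext fun i => ?_⟩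
    refine (slot_act (IndexEquiv.sigmaUnit ι) (A := A) _ ⟨i, ()⟩).trans ?_
    refine (slot_comp he (n' B) s i ()).trans ?_
    rw [slot_unary, slot_eq ((hn' B).sim_ident i)]
    exact M.ident_comp (s i)

/-! ### Central monoids -/

instance terminal.subsingleton_hom {ι : Type} [Finite ι] (A : ι → terminal.Obj)
    (B : terminal.Obj) : Subsingleton (terminal.Hom A B) :=
  ⟨fun f g => funext fun i =>
    @Subsingleton.elim _ (Discrete.instSubsingletonDiscreteHom (α := Unit) (A i) B) (f i) (g i)⟩

/-- The unique arrow `⋆, …, ⋆ → ⋆` of `1▸` with the given index set. -/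
def terminalHom (ι : Type) [Finite ι] : terminal.Hom (fun _ : ι => star) star :=
  fun _ => 𝟙 (⟨()⟩ : Discrete Unit)

/-- Parallel arrows of `1▸` coincide, so only the index sets have to be matched; they biject because
`p` holds at most once. -/
theorem terminal.isUnital {ι : Type} [Finite ι] (m : terminal.Hom (fun _ : ι => star) star) :
    IsUnital (terminalHom Empty) m := by
  intro p hp
  let σ : (Σ i, PLift (p i)) ≃ PLift (∃ i, p i) :=
    Equiv.ofBijective (fun x => ⟨x.1, x.2.down⟩) ⟨by
      rintro ⟨i, ⟨hi⟩⟩ ⟨j, ⟨hj⟩⟩ -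
      obtain rfl := hp i j hi hj
      rfl, fun ⟨i, hi⟩ => ⟨⟨i, ⟨hi⟩⟩, rfl⟩⟩
  have h := Rel.mk (M := terminal) (σ := σ) (A' := fun _ => star)
    (terminal.comp m (fun i => terminal.unitInsert (terminalHom Empty) (p i)))
  rw [Subsingleton.elim (terminal.act σ _)
    (terminal.unitInsert (X := star) (terminalHom Empty) (∃ i, p i))] at h
  exact ⟨σ, h⟩

theorem pairLeft_map {M : SymmMulticat.{u₁, v₁}} {N : SymmMulticat.{u₂, v₂}} (F : Functor M N)
    {X : M.Obj} (e : M.Hom (fun _ : Empty => X) X) (i : Fin 2) :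
    F.map (M.pairLeft e i) = N.pairLeft (X := F.obj X) (F.map e) i :=
  match i with
  | 0 => rfl
  | 1 => F.map_ident X

theorem pairRight_map {M : SymmMulticat.{u₁, v₁}} {N : SymmMulticat.{u₂, v₂}} (F : Functor M N)
    {X : M.Obj} (e : M.Hom (fun _ : Empty => X) X) (i : Fin 2) :
    F.map (M.pairRight e i) = N.pairRight (X := F.obj X) (F.map e) i :=
  match i with
  | 0 => F.map_ident X
  | 1 => rfl

/-- Functors preserve unital magmas. -/
def Functor.mapMagma {M : SymmMulticat.{u₁, v₁}} {N : SymmMulticat.{u₂, v₂}} (F : Functor M N)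
    {X : M.Obj} (m : UnitalMagma M X) : UnitalMagma N (F.obj X) where
  one := F.map m.one
  mul := F.map m.mul
  one_mul := by
    have h := congrArg F.map m.one_mul
    rw [F.map_act arityLeftEquiv (A := fun _ => X), F.map_comp, F.map_ident] at h
    simpa only [pairLeft_map] using h
  mul_one := by
    have h := congrArg F.map m.mul_one
    rw [F.map_act arityRightEquiv (A := fun _ => X), F.map_comp, F.map_ident] at h
    simpa only [pairRight_map] using h

/-- The unital magma `⋆` in `1▸`. -/
def terminalMagma : UnitalMagma terminal star where
  one := terminalHom Empty
  mul := terminalHom (Fin 2)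
  one_mul := Subsingleton.elim _ _
  mul_one := Subsingleton.elim _ _

theorem HasCentralMonoid.exists_functor {M : SymmMulticat.{u, v}} (h : M.HasCentralMonoid) :
    Nonempty (Functor terminal (center M)) := by
  obtain ⟨⟨obj, map, map_ident, map_comp, map_act⟩, h⟩ := h
  -- Every object of `1▸` is definitionally `star`.
  obtain rfl : obj = fun _ => Functor.idFunctor M := funext fun _ => h
  exact ⟨⟨fun _ => (), map, map_ident, map_comp, map_act⟩⟩

theorem HasCentralMonoid.hasCentralUnitalMagma {M : SymmMulticat.{u, v}}
    (h : M.HasCentralMonoid) : M.HasCentralUnitalMagma := by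
  obtain ⟨K⟩ := h.exists_functor
  exact ⟨K.mapMagma terminalMagma⟩

/-! ### Constructing functors into internal homs. -/

/-- The image of an arrow of `[M, N]` under composition with a functor `N → P`. -/
def MultiNat.postcomp {M : SymmMulticat.{u₁, v₁}} {N : SymmMulticat.{u₂, v₂}}
    {P : SymmMulticat.{u₃, v₃}} (G : Functor N P) {ι : Type} [Finite ι] {F : ι → Functor M N}
    {H : Functor M N} (α : MultiNat F H) : MultiNat (fun i => (F i).trans G) (H.trans G) where
  app A := G.map (α.app A)
  natural {μ} _ {A} {B} f := by
    have h := congrArg G.map (α.natural f)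
    exact (G.map_comp _ _).symm.trans (h.trans
      ((G.map_act (IndexEquiv.swap ι μ) (A := fun p => (F p.2).obj (A p.1)) _).trans
        (congrArg (P.act (IndexEquiv.swap ι μ) (A := fun p => G.obj ((F p.2).obj (A p.1))))
          (G.map_comp _ _))))

/-- Composition with a functor `N → P`, as a functor `[M, N] → [M, P]`. -/
def postcomp (M : SymmMulticat.{u₁, v₁}) {N : SymmMulticat.{u₂, v₂}} {P : SymmMulticat.{u₃, v₃}}
    (G : Functor N P) : Functor (internalHom M N) (internalHom M P) where
  obj F := Functor.trans F G
  map α := MultiNat.postcomp G α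
  map_ident _ := MultiNat.ext' fun _ => G.map_ident _
  map_comp _ _ := MultiNat.ext' fun _ => G.map_comp _ _
  map_act σ F _ _ := MultiNat.ext' fun A => G.map_act σ (A := fun j => Functor.obj (F j) A) _

/-- The transpose `L → [M, N]` of a functor `M → [L, N]`. -/
def transpose {L : SymmMulticat.{u₁, v₁}} {M : SymmMulticat.{u₂, v₂}} {N : SymmMulticat.{u₃, v₃}}
    (G : Functor M (internalHom L N)) : Functor L (internalHom M N) where
  obj X :=  G.trans (evalAt L N X)
  map {ι} _ {X Y} f :=
    { app := fun A => Functor.map (G.obj A) f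
      natural := fun {μ} _ {A} {B} g => by
        -- Naturality is symmetric in the two arrows: transposing this instance back gives the
        -- required equation.
        have h := MultiNat.natural (G.map g) f
        have h' := congrArg (N.act (IndexEquiv.swap ι μ)
          (A := fun p => Functor.obj (G.obj (A p.1)) (X p.2))) h
        exact (h'.trans ((N.act_act (IndexEquiv.swap μ ι) (IndexEquiv.swap ι μ)
          (A := fun p => Functor.obj (G.obj (A p.1)) (X p.2)) _).trans (N.act_refl _))).symm }
  map_ident X := MultiNat.ext' fun A => Functor.map_ident (G.obj A) X
  map_comp f g := MultiNat.ext' fun A => Functor.map_comp (G.obj A) f g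
  map_act σ _ _ f := MultiNat.ext' fun A => Functor.map_act (G.obj A) σ f

theorem tensor_interchange {L : SymmMulticat.{u₁, v₁}} {M : SymmMulticat.{u₂, v₂}} {ι κ : Type}
    [Finite ι] [Finite κ] {A : ι → L.Obj} {B : L.Obj} {X : κ → M.Obj} {Y : M.Obj}
    (f : L.Hom A B) (h : M.Hom X Y) :
    (tensor L M).comp (TensorHom.mk (TensorPre.left f Y))
        (fun i => TensorHom.mk (TensorPre.right (A i) h)) =
      (tensor L M).act (IndexEquiv.swap κ ι) (A := fun p => (A p.1, X p.2))
        ((tensor L M).comp (TensorHom.mk (TensorPre.right B h))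
          (fun j => TensorHom.mk (TensorPre.left f (X j)))) := by
  refine (TensorHom.comp_mk _ _).trans ((TensorHom.sound (TensorRel.interchange f h)).trans ?_)
  exact congrArg ((tensor L M).act (IndexEquiv.swap κ ι) (A := fun p => (A p.1, X p.2)))
    (TensorHom.comp_mk (TensorPre.right B h) fun j => TensorPre.left f (X j)).symm

/-- The canonical functor `L → [M, L ⊗ M]`. -/
noncomputable def toHomTensor (L : SymmMulticat.{u₁, v₁}) (M : SymmMulticat.{u₂, v₂}) :
    Functor L (internalHom M (tensor L M)) where
  obj X :=
    { obj := fun A => (X, A)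
      map := fun f => TensorHom.mk (TensorPre.right X f)
      map_ident := fun A => TensorHom.sound (TensorRel.right_ident X A)
      map_comp := fun f g => (TensorHom.sound (TensorRel.right_comp X f g)).trans
        (TensorHom.comp_mk _ _).symm
      map_act := fun σ _ _ f => TensorHom.sound (TensorRel.right_act σ X f) }
  map {ι} _ {X Y} f :=
    { app := fun A => TensorHom.mk (TensorPre.left f A)
      natural := fun {μ} _ {A} {B} g => by
        have h := congrArg ((tensor L M).act (IndexEquiv.swap ι μ)
          (A := fun p => (X p.2, A p.1))) (tensor_interchange f g)
        exact (h.trans (((tensor L M).act_act (IndexEquiv.swap μ ι) (IndexEquiv.swap ι μ)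
          (A := fun p => (X p.2, A p.1)) _).trans ((tensor L M).act_refl _))).symm }
  map_ident X := MultiNat.ext' fun A => TensorHom.sound (TensorRel.left_ident X A)
  map_comp f g := MultiNat.ext' fun A => (TensorHom.sound (TensorRel.left_comp f g A)).trans
        (TensorHom.comp_mk _ _).symm
  map_act σ _ _ f := MultiNat.ext' fun A => TensorHom.sound (TensorRel.left_act σ f A)

/-- Every functor `M → C▸` underlies a functor `1▸ → [M, C▸]`. -/
def monoidInSequential {C : Type u₂} [Category.{v₂} C] {M : SymmMulticat.{u, v}}
    (Φ : Functor M (sequential C)) : Functor terminal (internalHom M (sequential C)) where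
  obj _ := Φ
  map {ι} _ _ _ _ :=
    { app := fun A _ => @CategoryStruct.id C _ (Φ.obj A)
      natural := fun {μ} _ {A} {B} f => by
        refine (seqAct_eq (C := C) (IndexEquiv.swap ι μ) (A := fun p => Φ.obj (A p.1))
          (B := Φ.obj B) _ _ fun p => ?_).symm
        exact (Category.comp_id (obj := C) _).trans (Category.id_comp (obj := C) _).symm }
  map_ident _ := rfl
  map_comp _ _ := MultiNat.ext' fun A => funext fun _ => (Category.id_comp (obj := C) _).symm
  map_act σ _ _ _ := MultiNat.ext' fun A =>
    (seqAct_eq (C := C) σ (A := fun _ => Φ.obj A) (B := Φ.obj A) _ _ fun _ => rfl).symm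

/-- The families of identities at `Φ` are carried back along `Ψ`; the resulting monoid sits on
`Φ.trans Ψ`, the identity functor. -/
theorem IsSequential.hasCentralMonoid {M : SymmMulticat.{u, v}} (h : M.IsSequential) :
    M.HasCentralMonoid := by
  obtain ⟨C, _, Φ, Ψ, h, -⟩ := h
  exact ⟨(monoidInSequential Φ).trans (postcomp M Ψ), h⟩

/-- A section of `forget M` suffices: its transpose sends `⋆` to the section followed by evaluation
at `⋆`. -/
theorem hasCentralMonoid_of_isIso_forget {M : SymmMulticat.{u, v}} (h : (forget M).IsIso) :
    M.HasCentralMonoid := by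
  obtain ⟨G, -, h⟩ := h
  exact ⟨transpose G, h⟩

/-- A retraction of `toTensor M` suffices, because `toHomTensor` sends `⋆` to `toTensor M`. -/
theorem hasCentralMonoid_of_isIso_toTensor {M : SymmMulticat.{u, v}} (h : (toTensor M).IsIso) :
    M.HasCentralMonoid := by
  obtain ⟨G, h, -⟩ := h
  exact ⟨(toHomTensor terminal M).trans (postcomp M G), h⟩

/-! ### Commutative monoids in sequential multicategories -/

/-- Inserting units in all inputs of `m` but the `i`-th gives the identity of `⋆`. In `C▸` a nullary
arrow carries no data, so this insertion merely selects the `i`-th component of `G.map m`. -/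
theorem Functor.map_terminal_eq_id {C : Type u} [Category.{v} C]
    (G : Functor terminal (sequential C)) {ι : Type} [Finite ι] {A : ι → terminal.Obj}
    {B : terminal.Obj} (m : terminal.Hom A B) :
    G.map m = fun _ => @CategoryStruct.id C _ (G.obj star) := by
  funext i
  let σ : (Σ j, PLift (i = j)) ≃ Unit :=
    ⟨fun _ => (), fun _ => ⟨i, ⟨rfl⟩⟩, fun ⟨_, ⟨h⟩⟩ => by subst h; rfl, fun _ => rfl⟩
  let τ : Unit ≃ PLift (i = i) := ⟨fun _ => ⟨rfl⟩, fun _ => (), fun _ => rfl, fun _ => rfl⟩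
  -- A reindexed identity at `j = i` and a nullary arrow elsewhere.
  let d (j : ι) : terminal.Hom (fun _ : PLift (i = j) => A j) (A j) := terminalHom _
  have h₁ : G.map (d i) ⟨rfl⟩ = @CategoryStruct.id C _ (G.obj star) := by
    have h : d i = terminal.act τ (A := fun _ => star) (terminal.ident star) :=
      Subsingleton.elim _ _
    have h' := (congrArg G.map h).trans ((G.map_act τ (A := fun _ => star) _).trans
      (congrArg ((sequential C).act τ (A := fun _ => G.obj star)) (G.map_ident star)))
    refine (congrFun h' _).trans ?_
    exact seqAct_apply (C := C) τ (A := fun _ => G.obj star) (B := G.obj star) _ ()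
  have h₂ : terminal.act σ (A := fun _ => star) (terminal.comp m d) = terminal.ident star :=
    Subsingleton.elim _ _
  have h₃ := congrFun ((congrArg ((sequential C).act σ (A := fun _ => G.obj star))
    (G.map_comp m d)).symm.trans ((G.map_act σ (A := fun _ => star) _).symm.trans
      ((congrArg G.map h₂).trans (G.map_ident star)))) ()
  have h₄ := (seqAct_apply (C := C) σ (A := fun _ => G.obj star) (B := G.obj star)
    (fun p => @CategoryStruct.comp C _ _ _ _ (G.map (d p.1) p.2) (G.map m p.1))
    ⟨i, ⟨rfl⟩⟩).symm.trans h₃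
  exact (Category.id_comp (obj := C) _).symm.trans
    ((congrArg (fun z => @CategoryStruct.comp C _ _ _ _ z (G.map m i)) h₁).symm.trans h₄)

theorem IsSequential.isIso_forget {M : SymmMulticat.{u, v}} (h : M.IsSequential) :
    (forget M).IsIso := by
  obtain ⟨K, hK⟩ := h.hasCentralMonoid
  obtain ⟨C, _, Φ, Ψ, h, -⟩ := h
  refine Functor.isIso_of_bijective _ ⟨?_, fun A => ?_⟩ fun {ι} _ F G => ⟨?_, ?_⟩
  · intro (F : Functor terminal M) (G : Functor terminal M) (hFG : F.obj star = G.obj star)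
    -- After `Φ` both functors consist of identities on the same object; `Ψ` then cancels `Φ`.
    have key : F.trans Φ = G.trans Φ := by
      refine Functor.ext_heq (fun _ => congrArg Φ.obj hFG) fun {ι} _ _ _ m => ?_
      rw [Functor.map_terminal_eq_id, Functor.map_terminal_eq_id]
      have id_heq : ∀ {X Y : C}, X = Y → (fun _ : ι => 𝟙 X) ≍ (fun _ : ι => 𝟙 Y) := by
        rintro X _ rfl
        rfl
      exact id_heq (congrArg Φ.obj hFG)
    have h₁ : F.trans (Φ.trans Ψ) = G.trans (Φ.trans Ψ) := congrArg (·.trans Ψ) key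
    rw [h] at h₁
    exact h₁
  · exact ⟨K.trans (evalAt M M A), congrArg (fun F => Functor.obj F A) hK⟩
  · intro α β hαβ
    exact MultiNat.ext' fun _ => hαβ
  · intro (f : M.Hom (fun i => Functor.obj (F i) star) (Functor.obj G star))
    refine ⟨⟨fun _ => f, fun {μ} _ A B m => ?_⟩, rfl⟩
    -- Naturality may be tested after the faithful `Φ`, where the images of `m` are identities and
    -- impose no condition.
    refine Functor.map_injective_of_trans_eq h _ _ ?_
    have hF (i : ι) := Functor.map_terminal_eq_id (Functor.trans (F i) Φ) m
    have hG := Functor.map_terminal_eq_id (Functor.trans G Φ) m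
    refine (Φ.map_comp _ _).trans (Eq.trans ?_ ((Φ.map_act (IndexEquiv.swap ι μ)
      (A := fun p => Functor.obj (F p.2) (A p.1)) _).trans (congrArg
        ((sequential C).act (IndexEquiv.swap ι μ)
          (A := fun p => Φ.obj (Functor.obj (F p.2) (A p.1)))) (Φ.map_comp _ _))).symm)
    refine (seqAct_eq (C := C) (IndexEquiv.swap ι μ)
      (A := fun p => Φ.obj (Functor.obj (F p.2) (A p.1))) (B := Φ.obj (Functor.obj G B))
      _ _ fun p => ?_).symm
    have h₃ := congrFun (hF p.1) p.2
    have h₄ := congrFun hG p.2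
    refine (congrArg (fun z => @CategoryStruct.comp C _ _ _ _ z (Φ.map f p.1)) h₃).trans
      (Eq.trans ?_ (congrArg (fun z => @CategoryStruct.comp C _ _ _ _ (Φ.map f p.1) z) h₄).symm)
    exact (Category.id_comp (obj := C) _).trans (Category.comp_id (obj := C) _).symm

/-! ### Functors out of the tensor product -/

section uncurry

variable {L : SymmMulticat.{u₁, v₁}} {M : SymmMulticat.{u₂, v₂}} {N : SymmMulticat.{u₃, v₃}}
  (T : Functor L (internalHom M N))

/-- The image of an object of `L ⊗ M` under the functor induced by `T : L → [M, N]`. -/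
def uncurryObj (P : L.Obj × M.Obj) : N.Obj := Functor.obj (T.obj P.1) P.2

/-- The image of a formal arrow of `L ⊗ M` under the functor induced by `T : L → [M, N]`. -/
def uncurryPre : ∀ {ι : Type} [Finite ι] {P : ι → L.Obj × M.Obj} {Q : L.Obj × M.Obj},
    TensorPre L M P Q → N.Hom (fun i => uncurryObj T (P i)) (uncurryObj T Q)
  | _, _, _, _, @TensorPre.left _ _ _ _ _ _ f X => MultiNat.app (T.map f) X
  | _, _, _, _, @TensorPre.right _ _ _ _ _ _ A h => Functor.map (T.obj A) h
  | _, _, _, _, .ident P => N.ident (uncurryObj T P)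
  | _, _, _, _, @TensorPre.comp _ _ _ _ _ _ _ _ _ f g =>
    N.comp (uncurryPre f) (fun i => uncurryPre (g i))
  | _, _, _, _, @TensorPre.act _ _ _ _ _ _ σ P _ f =>
    N.act σ (A := fun j => uncurryObj T (P j)) (uncurryPre f)

/-- The `left` relations are functoriality of `T`, the `right` ones functoriality of each `T.obj A`,
and `interchange` is naturality of `T.map f` with the transposition undone. -/
theorem uncurryPre_eq {ι : Type} [Finite ι] {P : ι → L.Obj × M.Obj} {Q : L.Obj × M.Obj}
    {f g : TensorPre L M P Q} (h : TensorRel L M f g) : uncurryPre T f = uncurryPre T g := by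
  induction h with
  | refl f => rfl
  | symm _ ih => exact ih.symm
  | trans _ _ ih₁ ih₂ => exact ih₁.trans ih₂
  | comp_congr _ _ ih₁ ih₂ =>
    simp only [uncurryPre, ih₁, ih₂]
  | act_congr σ _ ih => simp only [uncurryPre, ih]
  | act_refl f => exact N.act_refl _
  | act_act σ τ f => exact N.act_act σ τ _
  | ident_comp f => exact N.ident_comp _
  | comp_ident f => exact N.comp_ident _
  | assoc f g h =>
    exact N.assoc (uncurryPre T f) (fun i => uncurryPre T (g i)) (fun i j => uncurryPre T (h i j))
  | comp_act σ f g => exact N.comp_act σ _ _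
  | act_comp σ f g => exact N.act_comp σ _ _
  | left_ident A X => exact congrArg (fun α => MultiNat.app α X) (T.map_ident A)
  | left_comp f g X => exact congrArg (fun α => MultiNat.app α X) (T.map_comp f g)
  | left_act σ f X => exact congrArg (fun α => MultiNat.app α X) (T.map_act σ f)
  | right_ident A X => exact Functor.map_ident (T.obj A) X
  | right_comp A f g => exact Functor.map_comp (T.obj A) f g
  | right_act σ A f => exact Functor.map_act (T.obj A) σ f
  | @interchange ι κ _ _ A B X Y f h =>
    have h₁ := congrArg (N.act (IndexEquiv.swap κ ι)
      (A := fun p => Functor.obj (T.obj (A p.1)) (X p.2))) (MultiNat.natural (T.map f) h)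
    exact (h₁.trans ((N.act_act (IndexEquiv.swap ι κ) (IndexEquiv.swap κ ι)
      (A := fun p => Functor.obj (T.obj (A p.1)) (X p.2)) _).trans (N.act_refl _))).symm

/-- The functor `L ⊗ M → N` induced by a functor `L → [M, N]`. -/
def uncurry : Functor (tensor L M) N where
  obj P := uncurryObj T P
  map f := Quotient.lift (uncurryPre T) (fun _ _ h => uncurryPre_eq T h) f
  map_ident _ := rfl
  map_comp f g := by
    obtain ⟨f, rfl⟩ := TensorHom.exists_rep f
    choose g' hg using fun i => TensorHom.exists_rep (g i)
    obtain rfl : (fun i => TensorHom.mk (g' i)) = g := funext hg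
    exact congrArg (Quotient.lift (uncurryPre T) (fun _ _ h => uncurryPre_eq T h))
      (TensorHom.comp_mk f g')
  map_act σ _ _ f := by
    obtain ⟨f, rfl⟩ := TensorHom.exists_rep f
    rfl

end uncurry

/-! ### The tensor product with `1▸` -/

/-- Two functors from `1▸` with the same value `X` at `⋆` are equal if they commute with each
other. -/
theorem map_eq_map_of_interchange {N : SymmMulticat.{u, v}} {X : N.Obj}
    (K L : Functor terminal (fullSub N (fun _ : Unit => X)))
    (h : ∀ {ι κ : Type} [Finite ι] [Finite κ] (m : terminal.Hom (fun _ : ι => star) star)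
      (n : terminal.Hom (fun _ : κ => star) star),
      N.comp (K.map m) (fun _ => L.map n) =
        N.act (IndexEquiv.swap κ ι) (A := fun _ => X) (N.comp (L.map n) fun _ => K.map m))
    {ι : Type} [Finite ι] (m : terminal.Hom (fun _ : ι => star) star) : K.map m = L.map m := by
  let J := fullSubInclusion N (fun _ : Unit => X)
  -- Interchange of two nullary arrows identifies the units.
  have he : J.map (K.map (terminalHom Empty)) = J.map (L.map (terminalHom Empty)) := by
    refine Sim.eq_of_subsingleton ?_
    refine (Sim.comp_of_isEmpty (J.map (K.map (terminalHom Empty)))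
      fun _ => J.map (L.map (terminalHom Empty))).symm.trans ?_
    refine Sim.trans ?_ (Sim.comp_of_isEmpty (J.map (L.map (terminalHom Empty)))
      fun _ => J.map (K.map (terminalHom Empty)))
    refine Sim.trans ?_ (Sim.act (IndexEquiv.swap Empty Empty) (A := fun _ => X) _).symm
    exact h (terminalHom Empty) (terminalHom Empty) ▸ Sim.refl _
  have hK := (terminal.isUnital m).map (K.trans J)
  have hL := (terminal.isUnital m).map (L.trans J)
  -- Since the units agree, the slots of `K.map m` with respect to the unit of `L` are identities,
  -- so `K.map m` is `L.map m` composed with identities.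
  have key := N.eq_act_comp_of_interchange (A := fun _ => X) (J.map (K.map m)) (fun _ => hL)
    (h m m) (s := fun _ => N.ident X) fun i => by
      have := hK.sim_ident i
      change Sim N (N.comp (J.map (K.map m)) fun j =>
        N.unitInsert (X := X) (J.map (K.map (terminalHom Empty))) (i = j)) (N.ident X) at this
      rw [he] at this
      exact this
  exact key.trans (N.comp_ident _)

/-- The commutative monoid structure on `⟨⋆, X⟩` given by the arrows of `1▸`. -/
noncomputable def leftMonoid (M : SymmMulticat.{u, v}) (X : M.Obj) :
    Functor terminal (fullSub (tensor terminal M) (fun _ : Unit => (star, X))) where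
  obj _ := ()
  map m := TensorHom.mk (TensorPre.left m X)
  map_ident A := TensorHom.sound (TensorRel.left_ident A X)
  map_comp f g := (TensorHom.sound (TensorRel.left_comp f g X)).trans (TensorHom.comp_mk _ _).symm
  map_act σ _ _ f := TensorHom.sound (TensorRel.left_act σ f X)

/-- The commutative monoid structure on `⟨⋆, X⟩` given by a central monoid in `M`. -/
noncomputable def rightMonoid {M : SymmMulticat.{u, v}} (K : Functor terminal (center M))
    (X : M.Obj) :
    Functor terminal (fullSub (tensor terminal M) (fun _ : Unit => (star, X))) where
  obj _ := ()
  map m := (toTensor M).map ((centerEval M X).map (K.map m))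
  map_ident A := ((K.trans (centerEval M X)).trans (toTensor M)).map_ident A
  map_comp f g := ((K.trans (centerEval M X)).trans (toTensor M)).map_comp f g
  map_act σ _ _ f := ((K.trans (centerEval M X)).trans (toTensor M)).map_act σ f

/-- Only the generators `left m X` need an argument: the interchange relation makes the two monoid
structures on `⟨⋆, X⟩` commute, so they are equal and `m_X` comes from the central monoid. -/
theorem exists_tensorRel_right {M : SymmMulticat.{u, v}} (K : Functor terminal (center M))
    {ι : Type} [Finite ι] {P : ι → terminal.Obj × M.Obj} {Q : terminal.Obj × M.Obj}
    (f : TensorPre terminal M P Q) :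
    ∃ g : M.Hom (fun i => (P i).2) Q.2, TensorRel terminal M f (TensorPre.right star g) := by
  induction f with
  | left m X =>
    exact ⟨(centerEval M X).map (K.map m), TensorHom.exact (map_eq_map_of_interchange
      (leftMonoid M X) (rightMonoid K X)
      (fun m n => tensor_interchange m ((centerEval M X).map (K.map n))) m)⟩
  | right A h => exact ⟨h, .refl _⟩
  | ident P => exact ⟨M.ident P.2, (TensorRel.right_ident star P.2).symm⟩
  | comp f g ihf ihg =>
    obtain ⟨f', hf⟩ := ihf
    choose g' hg using ihg
    exact ⟨M.comp f' g', (TensorRel.comp_congr hf hg).trans (TensorRel.right_comp star f' g').symm⟩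
  | @act _ _ _ _ σ P _ f ih =>
    obtain ⟨f', hf⟩ := ih
    exact ⟨M.act σ (A := fun j => (P j).2) f', (TensorRel.act_congr σ hf).trans
      (TensorRel.right_act σ (X := fun j => (P j).2) star f').symm⟩

theorem HasCentralMonoid.isIso_toTensor {M : SymmMulticat.{u, v}} (h : M.HasCentralMonoid) :
    (toTensor M).IsIso := by
  obtain ⟨K⟩ := h.exists_functor
  let T : Functor terminal (internalHom M M) := K.trans (fullSubInclusion _ _)
  -- On arrows `h_⋆` the functor `uncurry T` acts as `T.obj star`, which is the identity; this
  -- retraction gives injectivity on arrows.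
  have hT : (toTensor M).trans (uncurry T) = Functor.idFunctor M := rfl
  refine Functor.isIso_of_bijective _ ⟨fun A B h => congrArg Prod.snd h, fun P => ⟨P.2, rfl⟩⟩
    fun A B => ⟨Functor.map_injective_of_trans_eq hT A B, fun f => ?_⟩
  obtain ⟨f, rfl⟩ := TensorHom.exists_rep f
  obtain ⟨g, hg⟩ := exists_tensorRel_right K f
  exact ⟨g, TensorHom.sound hg.symm⟩

end SymmMulticat

/-! ### The equivalence of the six conditions. -/

theorem mainTheorem1 (M : SymmMulticat.{u, v}) :
    List.TFAE [
      M.IsSequential,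
      SymmMulticat.Isomorphic M (SymmMulticat.sequential (SymmMulticat.Underlying M)),
      M.HasCentralMonoid,
      M.HasCentralUnitalMagma,
      (SymmMulticat.forget M).IsIso,
      (SymmMulticat.toTensor M).IsIso] := by
  tfae_have 2 → 1 := fun h => ⟨SymmMulticat.Underlying M, inferInstance, h⟩
  tfae_have 1 → 3 := fun h => h.hasCentralMonoid
  tfae_have 3 → 4 := fun h => h.hasCentralUnitalMagma
  tfae_have 4 → 2 := fun h => h.isomorphic
  tfae_have 1 → 5 := fun h => h.isIso_forget
  tfae_have 5 → 3 := SymmMulticat.hasCentralMonoid_of_isIso_forget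
  tfae_have 3 → 6 := fun h => h.isIso_toTensor
  tfae_have 6 → 3 := SymmMulticat.hasCentralMonoid_of_isIso_toTensor
  tfae_finish
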